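/- Let $\Omega=\mathbb T^2=[0,1]^2$ be the two-dimensional unit torus, $\Upsilon=\Omega\times[0,2\pi)$ with periodic boundary conditions, $\xi=(x,\theta)\in\Upsilon$, $\mathbf e(\theta)=(\cos\theta,\sin\theta)$, and let $\nabla,\nabla\cdot,\Delta$ act in $x$ only, $\nabla_\xi=(\nabla,\partial_\theta)$. For $u\in L^1(\Omega)$ and a function $g$ on $\Upsilon$ put $\rho_g(x)=\int_0^{2\pi}g(x,\theta)\,d\theta$ and $\mathcal U(g)=u*\rho_g$ (convolution on $\Omega$). Say that $u$ satisfies the repulsion condition if $$\int_\Upsilon\nabla g\cdot\nabla\,\mathcal U(g)\,d\xi\ge 0\qquad\text{for all nonnegative } g\in C^2(\Upsilon).$$ There is a constant $c>0$ such that the following holds for every $u\in L^1(\Omega)$ satisfying the repulsion condition, every $\mathrm{Pe}\in\mathbb R$ and every mass $\varphi\ge 0$. Let $f=f(x,\theta,t)\ge 0$ be a classical solution, $f\in C(\Upsilon\times[0,\infty))\cap C^2(\Upsilon\times(0,\infty))$, of the mean-field model $$\partial_t f+\mathrm{Pe}\,\nabla\cdot(f\,\mathbf e(\theta))=\Delta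 f+\partial_\theta^2 f+\nabla\cdot\big(f\,\nabla(u*\rho_f)\big),\qquad t>0,$$ with $\int_\Upsilon f(\cdot,0)\,d\xi=\varphi$. Let $f_*=\varphi/(2\pi)$ be the homogeneous stationary state of mass $\varphi$, and let $H(t)=\int_\Upsilon f\log(f/f_*)\,d\xi$ be the relative entropy (with the integrand read as $0$ where $f=0$). Then: 1. For every $t>0$, $|\nabla_\xi f|^2/f$ (read as $0$ where $f=0$) is integrable over $\Upsilon$, $H$ is differentiable at $t$, and $$\frac{d}{dt}H=-\int_\Upsilon\Big[\frac{|\nabla f|^2}{f}+\frac{|\partial_\theta f|^2}{f}+\nabla f\cdot\nabla\,\mathcal U(f)\Big]d\xi\le-\int_\Upsilon\frac{|\nabla_\xi f|^2}{f}\,d\xi,\qquad \frac{d}{dt}H\le -c\,H .$$ 2. $H(t)\le e^{-ct}H(0)$ for all $t\ge 0$. 3. $\|f(\cdot,t)-f_*\|_{L^1(\Upsilon)}^2\le 2\varphi\,H(t)$ for all $t\ge0$; in particular $f(\cdot,t)\to f_*$ in $L^1(\Upsilon)$ as $t\to\infty$. Thus for every mass and every Péclet number the homogeneous state attracts all such solutions,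 so this model shows no motility-induced phase separation (MIPS). -/

import Mathlib

open MeasureTheory Set Filter Topology

noncomputable section

namespace ActiveBrownian

/-! Functions on the torus `Ω = [0,1]²` and on the phase space `Υ = Ω × [0,2π)` are represented by
their periodic lifts to `ℝ × ℝ` and to `(ℝ × ℝ) × ℝ` (the latter in curried form `g x θ`);
integrals are taken over one cell of periodicity. -/

/-- The cell `[0,1)²` of the spatial torus `Ω`. -/
def spaceCell : Set (ℝ × ℝ) := Ico (0 : ℝ) 1 ×ˢ Ico (0 : ℝ) 1

/-- The cell `[0,1)² × [0,2π)` of the phase space `Υ`. -/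
def phaseCell : Set ((ℝ × ℝ) × ℝ) := spaceCell ×ˢ Ico (0 : ℝ) (2 * Real.pi)

/-- `v` is (the lift of) a function on the torus `Ω`. -/
def SpacePeriodic (v : ℝ × ℝ → ℝ) : Prop :=
  ∀ x : ℝ × ℝ, v (x + (1, 0)) = v x ∧ v (x + (0, 1)) = v x

/-- `g` is (the lift of) a function on the phase space `Υ`. -/
def PhasePeriodic (g : ℝ × ℝ → ℝ → ℝ) : Prop :=
  (∀ θ : ℝ, SpacePeriodic (fun x => g x θ)) ∧
    ∀ (x : ℝ × ℝ) (θ : ℝ), g x (θ + 2 * Real.pi) = g x θ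

/-- The integral over the phase space `Υ`. -/
def phaseIntegral (g : ℝ × ℝ → ℝ → ℝ) : ℝ :=
  ∫ ξ in phaseCell, g ξ.1 ξ.2

/-- The gradient in the spatial variables. -/
def spaceGrad (v : ℝ × ℝ → ℝ) (x : ℝ × ℝ) : ℝ × ℝ :=
  (deriv (fun s => v (s, x.2)) x.1, deriv (fun s => v (x.1, s)) x.2)

/-- The divergence in the spatial variables. -/
def spaceDiv (F : ℝ × ℝ → ℝ × ℝ) (x : ℝ × ℝ) : ℝ :=
  deriv (fun s => (F (s, x.2)).1) x.1 + deriv (fun s => (F (x.1, s)).2) x.2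

/-- The Laplacian in the spatial variables. -/
def spaceLaplacian (v : ℝ × ℝ → ℝ) : ℝ × ℝ → ℝ :=
  spaceDiv (spaceGrad v)

/-- The Euclidean scalar product on `ℝ²`. -/
def dot (v w : ℝ × ℝ) : ℝ := v.1 * w.1 + v.2 * w.2

/-- The self-propulsion direction `e(θ) = (cos θ, sin θ)`. -/
def direction (θ : ℝ) : ℝ × ℝ := (Real.cos θ, Real.sin θ)

/-- The space density `ρ(x) = ∫₀^{2π} g(x,θ) dθ`. -/
def spaceDensity (g : ℝ × ℝ → ℝ → ℝ) (x : ℝ × ℝ) : ℝ :=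
  ∫ θ in (0 : ℝ)..(2 * Real.pi), g x θ

/-- The convolution `u ∗ ρ` on the torus `Ω` (equal to `∫ u (x - y) ρ y dy` by periodicity). -/
def torusConv (u ρ : ℝ × ℝ → ℝ) (x : ℝ × ℝ) : ℝ :=
  ∫ y in spaceCell, u y * ρ (x - y)

/-- The interaction term `𝒰(g) = u ∗ ρ`, with `ρ` the space density of `g`. -/
def interaction (u : ℝ × ℝ → ℝ) (g : ℝ × ℝ → ℝ → ℝ) : ℝ × ℝ → ℝ :=
  torusConv u (spaceDensity g)

/-- `∫_Υ ∇g · ∇(u ∗ ρ) dξ`. -/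
def interactionDissipation (u : ℝ × ℝ → ℝ) (g : ℝ × ℝ → ℝ → ℝ) : ℝ :=
  phaseIntegral fun x θ =>
    dot (spaceGrad (fun z => g z θ) x) (spaceGrad (interaction u g) x)

/-- The repulsion condition on the potential `u`: `∫_Υ ∇g · ∇(u ∗ ρ) dξ ≥ 0` for all nonnegative
`C²` functions `g` on the phase space. -/
def RepulsionCondition (u : ℝ × ℝ → ℝ) : Prop :=
  ∀ g : ℝ × ℝ → ℝ → ℝ, PhasePeriodic g →
    ContDiff ℝ 2 (fun ξ : (ℝ × ℝ) × ℝ => g ξ.1 ξ.2) →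
    (∀ x θ, 0 ≤ g x θ) → 0 ≤ interactionDissipation u g

/-- `f t x θ` is a nonnegative classical solution, for `t ≥ 0`, of
`∂ₜ f + Pe ∇·(f e(θ)) = Δ f + ∂_θ² f + ∇·(f ∇(u ∗ ρ))` on the phase space `Υ`. Values of `f` at
negative times play no role. -/
structure IsModel1Solution (u : ℝ × ℝ → ℝ) (Pe : ℝ) (f : ℝ → ℝ × ℝ → ℝ → ℝ) : Prop where
  periodic : ∀ t, 0 ≤ t → PhasePeriodic (f t)
  nonneg : ∀ t, 0 ≤ t → ∀ x θ, 0 ≤ f t x θ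
  continuousOn : ContinuousOn (fun p : ℝ × (ℝ × ℝ) × ℝ => f p.1 p.2.1 p.2.2)
    (Ici (0 : ℝ) ×ˢ univ)
  contDiffOn : ContDiffOn ℝ 2 (fun p : ℝ × (ℝ × ℝ) × ℝ => f p.1 p.2.1 p.2.2)
    (Ioi (0 : ℝ) ×ˢ univ)
  equation : ∀ t, 0 < t → ∀ x θ,
    deriv (fun s => f s x θ) t + Pe * spaceDiv (fun z => f t z θ • direction θ) x =
      spaceLaplacian (fun z => f t z θ) x + deriv (deriv (fun a => f t x a)) θ +
        spaceDiv (fun z => f t z θ • spaceGrad (interaction u (f t)) z) x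

/-- The homogeneous state `f_* = φ / 2π` of mass `φ`. -/
def homogeneousState (φ : ℝ) : ℝ := φ / (2 * Real.pi)

/-- The relative entropy `∫_Υ g log (g / f_*) dξ` (with `0 log 0 = 0`). -/
def relEntropy (φ : ℝ) (g : ℝ × ℝ → ℝ → ℝ) : ℝ :=
  phaseIntegral fun x θ => g x θ * Real.log (g x θ / homogeneousState φ)

/-- The density `|∇_ξ g|² / g` of the Fisher information, in all three variables `ξ = (x, θ)`. For
nonnegative `g` the gradient vanishes wherever `g` does, and the quotient is read as `0` there. -/
def fisherDensity (g : ℝ × ℝ → ℝ → ℝ) (x : ℝ × ℝ) (θ : ℝ) : ℝ :=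
  (dot (spaceGrad (fun z => g z θ) x) (spaceGrad (fun z => g z θ) x)
    + deriv (fun a => g x a) θ ^ 2) / g x θ

/-- The Fisher information `∫_Υ |∇_ξ g|² / g dξ`. -/
def fisherInfo (g : ℝ × ℝ → ℝ → ℝ) : ℝ :=
  phaseIntegral (fisherDensity g)

/-- The distance `‖g - f_*‖` in `L¹(Υ)`. -/
def l1Dist (φ : ℝ) (g : ℝ × ℝ → ℝ → ℝ) : ℝ :=
  phaseIntegral fun x θ => |g x θ - homogeneousState φ|

end ActiveBrownian

end

open ActiveBrownian

/-! The relative entropy is a Lyapunov functional. Testing the equation with `log f + 1` and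
integrating by parts on the torus, diffusion produces minus the Fisher information and the
interaction produces minus `∫ ∇f · ∇𝒰(f)`. The transport term contributes nothing: `e(θ)` does not
depend on `x`, so `e(θ) · ∇Λ(f)` integrates to zero for every primitive `Λ`. The Péclet number
therefore disappears. Repulsion gives the interaction term a sign, so `H' ≤ -(Fisher information)`.
A logarithmic Sobolev inequality turns this into `H' ≤ -c H`, Gronwall's argument gives exponential
decay, and the Csiszár–Kullback–Pinsker inequality transfers it to `L¹`.

Two points need work. First, `f` may vanish, so `log f` is not an admissible test function. The
remedy is that a nonnegative `C²` function satisfies `|∂g|² ≤ C g` locally (`exists_sq_fderiv_le`).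
Applied in space-time, it bounds the Fisher density, makes `∂ₜf (log f + 1)` bounded, and makes all
derivatives vanish at zeros of `f`. The identity is proved with `log (f + ε)` and then `ε → 0` by
dominated convergence (`integral_modelOperator_mul_log`).

Second, the logarithmic Sobolev inequality (`entropy_phaseCell_le`) is proved with a crude explicit
constant. In one dimension the oscillation of `g` is at most `∫ |g'|`, which Cauchy–Schwarz bounds
by Fisher information times mass, and entropy is bounded by variance over mean (`entropy_Ico_le`).
The three variables are then integrated out one at a time: the entropy of `f` is compared with that
of successive marginals, and each step costs the Fisher information in one variable. -/

namespace ActiveBrownian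

/-! ### Differentiation of integrals depending on a parameter -/

/-- An integral over a bounded set of a jointly smooth function against an integrable weight
depends smoothly on the parameter. -/
theorem contDiff_setIntegral_smul {E Y : Type} [NormedAddCommGroup E] [NormedSpace ℝ E]
    [FiniteDimensional ℝ E] [NormedAddCommGroup Y] [NormedSpace ℝ Y] [FiniteDimensional ℝ Y]
    [MeasurableSpace Y] [BorelSpace Y] {μ : Measure Y} {s K : Set Y} (hs : MeasurableSet s)
    (hK : IsCompact K) (hsK : s ⊆ K) {w : Y → ℝ} (hw : IntegrableOn w s μ) (n : ℕ) :
    ∀ {G : Type} [NormedAddCommGroup G] [NormedSpace ℝ G] (F : E → Y → G),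
      ContDiff ℝ n (Function.uncurry F) →
      ContDiff ℝ n (fun x => ∫ y in s, w y • F x y ∂μ) := by
  have : ProperSpace E := FiniteDimensional.proper_real E
  have : ProperSpace Y := FiniteDimensional.proper_real Y
  have key : ∀ {G : Type} [NormedAddCommGroup G] [NormedSpace ℝ G] (F : E → Y → G),
      Continuous (Function.uncurry F) → ∀ x₀, ∃ C : ℝ,
        (∀ x ∈ Metric.closedBall x₀ 1, ∀ y ∈ s, ‖w y • F x y‖ ≤ ‖w y‖ * C) := by
    intro G _ _ F hF x₀
    obtain ⟨C, hC⟩ := ((isCompact_closedBall x₀ (1 : ℝ)).prod hK).exists_bound_of_continuousOn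
      hF.continuousOn
    refine ⟨C, fun x hx y hy => ?_⟩
    rw [norm_smul]
    exact mul_le_mul_of_nonneg_left (hC (x, y) ⟨hx, hsK hy⟩) (norm_nonneg _)
  have hmeas : ∀ {G : Type} [NormedAddCommGroup G] [NormedSpace ℝ G] (F : E → Y → G),
      Continuous (Function.uncurry F) → ∀ x,
        AEStronglyMeasurable (fun y => w y • F x y) (μ.restrict s) := by
    intro G _ _ F hF x
    have : Continuous (F x) := hF.comp (by fun_prop : Continuous fun y => (x, y))
    exact hw.aestronglyMeasurable.smul this.aestronglyMeasurable
  have hnhds : ∀ x₀ : E, Metric.closedBall x₀ 1 ∈ 𝓝 x₀ :=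
    fun x₀ => Metric.closedBall_mem_nhds x₀ one_pos
  induction n with
  | zero =>
    intro G _ _ F hF
    have hF : Continuous (Function.uncurry F) := hF.continuous
    refine contDiff_zero.2 (continuous_iff_continuousAt.2 fun x₀ => ?_)
    obtain ⟨C, hC⟩ := key F hF x₀
    refine continuousAt_of_dominated (bound := fun y => ‖w y‖ * C)
      (Eventually.of_forall (hmeas F hF)) ?_ (hw.norm.mul_const C) ?_
    · filter_upwards [hnhds x₀] with x hx
      exact ae_restrict_of_forall_mem hs (hC x hx)
    · refine Eventually.of_forall fun y => ?_
      exact (continuous_const.smul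
        (hF.comp (by fun_prop : Continuous fun x => (x, y)))).continuousAt
  | succ n ih =>
    intro G _ _ F hF
    have hF1 : ContDiff ℝ ((n : WithTop ℕ∞) + 1) (Function.uncurry F) := by exact_mod_cast hF
    have hD : ContDiff ℝ n (fderiv ℝ (Function.uncurry F)) :=
      (contDiff_succ_iff_fderiv.1 hF1).2.2
    -- The `x`-derivative is again a weighted integral, with values in `E →L[ℝ] G`; this is why the
    -- induction quantifies over the target space. The weight is never differentiated, so
    -- integrability of `w` suffices.
    let F' : E → Y → E →L[ℝ] G := fun x y =>
      (fderiv ℝ (Function.uncurry F) (x, y)).comp (ContinuousLinearMap.inl ℝ E Y)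
    have hF' : ContDiff ℝ n (Function.uncurry F') :=
      hD.clm_comp contDiff_const
    have hgoal : ContDiff ℝ ((n : WithTop ℕ∞) + 1) (fun x => ∫ y in s, w y • F x y ∂μ) := by
      refine contDiff_succ_iff_hasFDerivAt.2 ⟨_, ih F' hF', fun x₀ => ?_⟩
      obtain ⟨C, hC⟩ := key F' hF'.continuous x₀
      obtain ⟨C₀, hC₀⟩ := key F hF1.continuous x₀
      refine hasFDerivAt_integral_of_dominated_of_fderiv_le
        (F' := fun x y => w y • F' x y) (bound := fun y => ‖w y‖ * C) (hnhds x₀)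
        (Eventually.of_forall (hmeas F hF1.continuous)) ?_ (hmeas F' hF'.continuous x₀)
        (ae_restrict_of_forall_mem hs fun y hy x hx => hC x hx y hy)
        (hw.norm.mul_const C) ?_
      · refine Integrable.mono' (hw.norm.mul_const C₀) (hmeas F hF1.continuous x₀) ?_
        exact ae_restrict_of_forall_mem hs (hC₀ x₀ (Metric.mem_closedBall_self zero_le_one))
      · refine Eventually.of_forall fun y x _ => ?_
        have h1 : HasFDerivAt (Function.uncurry F) (fderiv ℝ (Function.uncurry F) (x, y)) (x, y) :=
          (hF1.differentiable (by simp)).differentiableAt.hasFDerivAt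
        have h2 : HasFDerivAt (fun x => F x y) (F' x y) x :=
          HasFDerivAt.comp (g := Function.uncurry F) (f := fun x => (x, y)) x h1
            (hasFDerivAt_prodMk_left (𝕜 := ℝ) x y)
        exact h2.const_smul (w y)
    exact_mod_cast hgoal

/-! ### The square of the gradient of a nonnegative function -/

/-- If `g ≥ 0` on `[-δ, δ]`, then `g'(0)² ≤ 4 M g(0)` where `M` bounds `g''` and `|g'(0)| ≤ M δ`. -/
theorem sq_deriv_le_of_nonneg {g g' g'' : ℝ → ℝ} {δ M : ℝ} (hδ : 0 < δ) (hM : 0 < M)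
    (hg : ∀ s ∈ Icc (-δ) δ, HasDerivAt g (g' s) s)
    (hg' : ∀ s ∈ Icc (-δ) δ, HasDerivAt g' (g'' s) s)
    (h0 : ∀ s ∈ Icc (-δ) δ, 0 ≤ g s) (h1 : |g' 0| ≤ M * δ)
    (h2 : ∀ s ∈ Icc (-δ) δ, |g'' s| ≤ M) : g' 0 ^ 2 ≤ 4 * M * g 0 := by
  have hz : (0 : ℝ) ∈ Icc (-δ) δ := ⟨by linarith, hδ.le⟩
  -- `h` minimises the upper bound `g 0 + g' 0 * s + M * s ^ 2`, and nonnegativity of `g h` gives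
  -- the claim. The mean value inequality yields `M * s ^ 2` rather than half of it, whence the
  -- constant `4 * M`.
  set h : ℝ := -(g' 0) / (2 * M) with hh
  have habs : |h| ≤ δ := by
    rw [hh, abs_div, abs_neg, abs_of_pos (by positivity : 0 < 2 * M), div_le_iff₀ (by positivity)]
    nlinarith [abs_nonneg (g' 0)]
  have hmem : h ∈ Icc (-δ) δ := abs_le.1 habs
  have hsub : Icc (-|h|) |h| ⊆ Icc (-δ) δ := Icc_subset_Icc (neg_le_neg habs) habs
  have hd : ∀ s ∈ Icc (-|h|) |h|, ‖g' s - g' 0‖ ≤ M * |h| := by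
    intro s hs
    have := (convex_Icc (-δ) δ).norm_image_sub_le_of_norm_hasDerivWithin_le
      (fun x hx => (hg' x hx).hasDerivWithinAt) (C := M) (by simpa using h2) hz (hsub hs)
    refine this.trans (mul_le_mul_of_nonneg_left ?_ hM.le)
    simpa using abs_le.2 hs
  have hmem' : h ∈ Icc (-|h|) |h| := ⟨neg_abs_le h, le_abs_self h⟩
  have hz' : (0 : ℝ) ∈ Icc (-|h|) |h| := ⟨by simp, abs_nonneg h⟩
  have := (convex_Icc (-|h|) |h|).norm_image_sub_le_of_norm_hasDerivWithin_le
      (f := fun s => g s - g' 0 * s) (f' := fun s => g' s - g' 0)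
      (fun x hx => by
        refine HasDerivAt.hasDerivWithinAt ?_
        exact ((hg x (hsub hx)).sub ((hasDerivAt_id x).const_mul (g' 0))).congr_deriv (by simp))
      hd hz' hmem'
  have h3 := (abs_le.1 (by simpa using this : |g h - g' 0 * h - g 0| ≤ M * |h| * |h|)).2
  have h4 := h0 h hmem
  have h5 : M * |h| * |h| = M * h ^ 2 := by rw [mul_assoc, abs_mul_abs_self, sq]
  have h6 : 2 * M * h = - g' 0 := by rw [hh]; field_simp
  have h7 : 0 ≤ g 0 + g' 0 * h + M * h ^ 2 := by linarith
  have h8 : 0 ≤ 4 * M * (g 0 + g' 0 * h + M * h ^ 2) := by positivity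
  have h9 : 4 * M * (g 0 + g' 0 * h + M * h ^ 2)
      = 4 * M * g 0 + 2 * g' 0 * (2 * M * h) + (2 * M * h) ^ 2 := by ring
  rw [h9, h6] at h8
  nlinarith

/-- On a compact set, the square of a directional derivative of a nonnegative `C²` function is
bounded by a multiple of the function. -/
theorem exists_sq_fderiv_le {E : Type*} [NormedAddCommGroup E] [NormedSpace ℝ E]
    [FiniteDimensional ℝ E] {g : E → ℝ} {Ω K : Set E} (hΩ : IsOpen Ω) (hg : ContDiffOn ℝ 2 g Ω)
    (h0 : ∀ x ∈ Ω, 0 ≤ g x) (hK : IsCompact K) (hKΩ : K ⊆ Ω) (v : E) :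
    ∃ C, 0 ≤ C ∧ ∀ x ∈ K, (fderiv ℝ g x v) ^ 2 ≤ C * g x := by
  have : ProperSpace E := FiniteDimensional.proper_real E
  obtain ⟨η, hη, hηΩ⟩ := hK.exists_cthickening_subset_open hΩ hKΩ
  set K' := Metric.cthickening η K
  have hK' : IsCompact K' := hK.cthickening
  have hD : ContDiffOn ℝ 1 (fderiv ℝ g) Ω := hg.fderiv_of_isOpen hΩ (by norm_num)
  have hD2 : ContinuousOn (fderiv ℝ (fderiv ℝ g)) Ω :=
    hD.continuousOn_fderiv_of_isOpen hΩ (by norm_num)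
  obtain ⟨C1, hC1⟩ := hK'.exists_bound_of_continuousOn (hD.continuousOn.mono hηΩ)
  obtain ⟨C2, hC2⟩ := hK'.exists_bound_of_continuousOn (f := fderiv ℝ (fderiv ℝ g)) (hD2.mono hηΩ)
  set δ : ℝ := η / (‖v‖ + 1) with hδdef
  have hδ : 0 < δ := by positivity
  -- The first summand ensures `|g' 0| ≤ M * δ` along each segment, the second bounds the second
  -- derivative in direction `v`, and the last makes `M` positive.
  set M : ℝ := |C1| * ‖v‖ / δ + |C2| * ‖v‖ * ‖v‖ + 1 with hMdef
  have hM : 0 < M := by positivity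
  refine ⟨4 * M, by positivity, fun x hx => ?_⟩
  have hline : ∀ s ∈ Icc (-δ) δ, x + s • v ∈ K' := by
    intro s hs
    refine Metric.mem_cthickening_of_dist_le _ x _ _ hx ?_
    rw [dist_eq_norm, add_sub_cancel_left, norm_smul]
    calc ‖s‖ * ‖v‖ ≤ δ * (‖v‖ + 1) := by
          gcongr
          · exact abs_le.2 hs
          · linarith
      _ = η := by rw [hδdef]; field_simp
  have hlin : ∀ s : ℝ, HasDerivAt (fun s : ℝ => x + s • v) v s := fun s => by
    simpa using ((hasDerivAt_id s).smul_const v).const_add x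
  have := sq_deriv_le_of_nonneg (g := fun s => g (x + s • v))
    (g' := fun s => fderiv ℝ g (x + s • v) v)
    (g'' := fun s => fderiv ℝ (fderiv ℝ g) (x + s • v) v v) hδ hM ?_ ?_ ?_ ?_ ?_
  · simpa using this
  · intro s hs
    have hm := hΩ.mem_nhds (hηΩ (hline s hs))
    exact ((hg.contDiffAt hm).differentiableAt (by norm_num)).hasFDerivAt.comp_hasDerivAt s (hlin s)
  · intro s hs
    have hm := hΩ.mem_nhds (hηΩ (hline s hs))
    have := ((hD.contDiffAt hm).differentiableAt (by norm_num)).hasFDerivAt.comp_hasDerivAt s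
      (hlin s)
    exact (this.clm_apply (hasDerivAt_const s v)).congr_deriv (by simp)
  · exact fun s hs => h0 _ (hηΩ (hline s hs))
  · have hx' : x ∈ K' := Metric.self_subset_cthickening K hx
    have h1 : ‖fderiv ℝ g x v‖ ≤ |C1| * ‖v‖ :=
      (ContinuousLinearMap.le_opNorm _ _).trans
        (mul_le_mul_of_nonneg_right ((hC1 x hx').trans (le_abs_self _)) (norm_nonneg _))
    have h2 : |C1| * ‖v‖ = |C1| * ‖v‖ / δ * δ := by field_simp
    have h3 : |C1| * ‖v‖ / δ * δ ≤ M * δ := by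
      gcongr
      rw [hMdef]; nlinarith [show 0 ≤ |C2| * ‖v‖ * ‖v‖ by positivity]
    simpa using h1.trans (h2.trans_le h3)
  · intro s hs
    have h1 : ‖fderiv ℝ (fderiv ℝ g) (x + s • v) v v‖ ≤ |C2| * ‖v‖ * ‖v‖ := by
      refine (ContinuousLinearMap.le_opNorm _ _).trans
        (mul_le_mul_of_nonneg_right ?_ (norm_nonneg _))
      exact (ContinuousLinearMap.le_opNorm _ _).trans
        (mul_le_mul_of_nonneg_right ((hC2 _ (hline s hs)).trans (le_abs_self _)) (norm_nonneg _))
    have h2 : 0 ≤ |C1| * ‖v‖ / δ := by positivity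
    rw [← Real.norm_eq_abs]
    linarith

/-! ### Elementary inequalities -/

/-- The Cauchy–Schwarz inequality in the form `(∫ |h|)² ≤ ∫ q · ∫ f` whenever `h² ≤ q f`. -/
theorem sq_integral_abs_le {α : Type*} [MeasurableSpace α] {μ : Measure α} {h q f : α → ℝ}
    (hq : Integrable q μ) (hf : Integrable f μ) (hh : Integrable h μ)
    (hq0 : ∀ᵐ a ∂μ, 0 ≤ q a) (hf0 : ∀ᵐ a ∂μ, 0 ≤ f a) (hle : ∀ᵐ a ∂μ, h a ^ 2 ≤ q a * f a) :
    (∫ a, |h a| ∂μ) ^ 2 ≤ (∫ a, q a ∂μ) * ∫ a, f a ∂μ := by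
  -- The quadratic `q l² - 2 |h| l + f` is pointwise nonnegative, including where `q = 0`, since
  -- there `h = 0`. Its integral is nonnegative for all `l`, so the discriminant is nonpositive.
  have key : ∀ l : ℝ, 0 ≤ (∫ a, q a ∂μ) * (l * l) + (-2 * ∫ a, |h a| ∂μ) * l + ∫ a, f a ∂μ := by
    intro l
    have h1 : 0 ≤ ∫ a, (q a * (l * l) + (-2 * |h a|) * l + f a) ∂μ := by
      refine integral_nonneg_of_ae ?_
      filter_upwards [hq0, hf0, hle] with a h1 h2 h3
      have h3 : |h a| ^ 2 ≤ q a * f a := by rwa [sq_abs]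
      simp only [Pi.zero_apply]
      rcases h1.eq_or_lt with h4 | h4
      · rw [← h4, zero_mul] at h3
        have : |h a| = 0 := by nlinarith [abs_nonneg (h a)]
        rw [this, ← h4]; simpa using h2
      · have : 0 ≤ q a * (q a * (l * l) + (-2 * |h a|) * l + f a) := by
          nlinarith [sq_nonneg (q a * l - |h a|)]
        exact nonneg_of_mul_nonneg_right this h4
    rw [integral_add, integral_add, integral_mul_const, integral_mul_const,
      integral_const_mul] at h1
    · exact h1
    · exact hq.mul_const _
    · exact (hh.abs.const_mul _).mul_const _
    · exact (hq.mul_const _).add ((hh.abs.const_mul _).mul_const _)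
    · exact hf
  have := discrim_le_zero key
  rw [discrim] at this
  nlinarith

/-- The pointwise inequality behind Pinsker's inequality with the sharp constant. -/
theorem three_mul_sq_sub_one_le {x : ℝ} (hx : 0 ≤ x) :
    3 * (x - 1) ^ 2 ≤ (2 * x + 4) * (x * Real.log x - x + 1) := by
  rcases hx.eq_or_lt with rfl | hx
  · norm_num
  -- The difference `g` of the two sides has `g' = 4 p`; `p` is increasing and vanishes at `1`, so
  -- `g` attains its minimum `0` at `1`.
  set p : ℝ → ℝ := fun x => (x + 1) * Real.log x - 2 * (x - 1)
  set g : ℝ → ℝ := fun x => (2 * x + 4) * (x * Real.log x - x + 1) - 3 * (x - 1) ^ 2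
  have hp : ∀ x : ℝ, 0 < x → HasDerivAt p (Real.log x + (x + 1) * x⁻¹ - 2) x := by
    intro x hx
    have h1 := ((hasDerivAt_id x).add_const 1).mul (Real.hasDerivAt_log hx.ne')
    have h2 := ((hasDerivAt_id x).sub_const 1).const_mul 2
    exact (h1.sub h2).congr_deriv (by simp)
  have hg : ∀ x : ℝ, 0 < x → HasDerivAt g (4 * p x) x := by
    intro x hx
    have h1 := (((hasDerivAt_id x).const_mul 2).add_const 4).mul
      ((((hasDerivAt_id x).mul (Real.hasDerivAt_log hx.ne')).sub (hasDerivAt_id x)).add_const 1)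
    have h2 := (((hasDerivAt_id x).sub_const 1).pow 2).const_mul 3
    refine (h1.sub h2).congr_deriv ?_
    simp [p]
    field_simp
    ring
  have hpm : MonotoneOn p (Ioi 0) := by
    refine monotoneOn_of_deriv_nonneg (convex_Ioi 0)
      (fun x hx => (hp x hx).continuousAt.continuousWithinAt)
      (fun x hx => ((hp x (interior_subset hx)).differentiableAt).differentiableWithinAt) ?_
    intro x hx
    have hx : 0 < x := interior_subset hx
    rw [(hp x hx).deriv]
    have h1 := Real.one_sub_inv_le_log_of_pos hx
    have h2 : (x + 1) * x⁻¹ = 1 + x⁻¹ := by field_simp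
    linarith
  have hp1 : p 1 = 0 := by simp [p]
  have hg1 : g 1 = 0 := by simp [g]
  suffices 0 ≤ g x by simpa [g] using this
  rw [← hg1]
  rcases le_total x 1 with h | h
  · refine antitoneOn_of_deriv_nonpos (convex_Ioc 0 1)
      (fun y hy => (hg y hy.1).continuousAt.continuousWithinAt)
      (fun y hy => (hg y (interior_subset hy).1).differentiableAt.differentiableWithinAt)
      ?_ ⟨hx, h⟩ ⟨one_pos, le_rfl⟩ h
    intro y hy
    have hy := interior_subset hy
    rw [(hg y hy.1).deriv]
    have := hpm (show y ∈ Ioi 0 from hy.1) (show (1 : ℝ) ∈ Ioi 0 from mem_Ioi.2 zero_lt_one) hy.2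
    linarith
  · refine monotoneOn_of_deriv_nonneg (convex_Ici 1)
      (fun y hy => (hg y (one_pos.trans_le hy)).continuousAt.continuousWithinAt)
      (fun y hy => (hg y (one_pos.trans_le (interior_subset hy))).differentiableAt.differentiableWithinAt)
      ?_ (self_mem_Ici) h h
    intro y hy
    have hy : 1 ≤ y := interior_subset hy
    have hy0 := one_pos.trans_le hy
    rw [(hg y hy0).deriv]
    have := hpm (show (1 : ℝ) ∈ Ioi 0 from mem_Ioi.2 zero_lt_one) (show y ∈ Ioi 0 from hy0) hy
    linarith

/-- `y ↦ y log y` composed with a nonnegative function is differentiable also at the zeros of that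
function, provided the function is dominated there by a square. -/
theorem hasDerivAt_mul_log_of_nonneg {g : ℝ → ℝ} {g' t : ℝ} (hg : HasDerivAt g g' t)
    (h0 : ∀ᶠ s in 𝓝 t, 0 ≤ g s)
    (hsq : g t = 0 → ∃ C, ∀ᶠ s in 𝓝 t, g s ≤ C * (s - t) ^ 2) :
    HasDerivAt (fun s => g s * Real.log (g s)) (g' * (Real.log (g t) + 1)) t := by
  by_cases ht : g t = 0
  · obtain ⟨C, hC⟩ := hsq ht
    have hmin : IsLocalMin g t := by
      filter_upwards [h0] with s hs
      rwa [ht]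
    have hg' : g' = 0 := hmin.hasDerivAt_eq_zero hg
    rw [hg', zero_mul, hasDerivAt_iff_isLittleO]
    simp only [ht, zero_mul, sub_zero, smul_zero]
    -- At a zero of `g`, the quadratic bound makes `√g` of order `s - t`, while `√g log √g` tends to
    -- `0`; the product is `o(s - t)`.
    have h1 : (fun s => g s * Real.log (g s)) =ᶠ[𝓝 t]
        fun s => (2 * √(g s)) * (√(g s) * Real.log √(g s)) := by
      filter_upwards [h0] with s hs
      have h2 : Real.log √(g s) = Real.log (g s) / 2 := Real.log_sqrt hs
      rw [h2]
      calc g s * Real.log (g s) = √(g s) * √(g s) * Real.log (g s) := by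
            rw [Real.mul_self_sqrt hs]
        _ = _ := by ring
    refine h1.trans_isLittleO ?_
    have h2 : (fun s => 2 * √(g s)) =O[𝓝 t] fun s => s - t := by
      refine Asymptotics.IsBigO.of_bound (2 * √|C|) ?_
      filter_upwards [hC] with s hs
      rw [norm_mul, Real.norm_of_nonneg (Real.sqrt_nonneg _), Real.norm_ofNat, mul_assoc,
        Real.norm_eq_abs, ← Real.sqrt_sq_eq_abs (s - t), ← Real.sqrt_mul (abs_nonneg _)]
      gcongr
      exact hs.trans (by gcongr; exact le_abs_self C)
    have h3 : (fun s => √(g s) * Real.log √(g s)) =o[𝓝 t] fun _ => (1 : ℝ) := by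
      rw [Asymptotics.isLittleO_one_iff]
      have : ContinuousAt (fun s => √(g s) * Real.log √(g s)) t :=
        Real.continuous_mul_log.continuousAt.comp hg.continuousAt.sqrt
      simpa [ContinuousAt, ht] using this
    simpa using h2.mul_isLittleO h3
  · have := hg.mul (hg.log ht)
    exact this.congr_deriv (by field_simp)

/-! ### Integration over the cells -/

theorem measurableSet_spaceCell : MeasurableSet spaceCell := measurableSet_Ico.prod measurableSet_Ico

theorem measurableSet_phaseCell : MeasurableSet phaseCell :=
  measurableSet_spaceCell.prod measurableSet_Ico

/-- The closure of the space cell. -/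
def closedSpaceCell : Set (ℝ × ℝ) := Icc (0 : ℝ) 1 ×ˢ Icc (0 : ℝ) 1

/-- The closure of the phase cell. -/
def closedPhaseCell : Set ((ℝ × ℝ) × ℝ) := closedSpaceCell ×ˢ Icc (0 : ℝ) (2 * Real.pi)

theorem isCompact_closedSpaceCell : IsCompact closedSpaceCell := isCompact_Icc.prod isCompact_Icc

theorem isCompact_closedPhaseCell : IsCompact closedPhaseCell :=
  isCompact_closedSpaceCell.prod isCompact_Icc

theorem spaceCell_subset : spaceCell ⊆ closedSpaceCell :=
  prod_mono Ico_subset_Icc_self Ico_subset_Icc_self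

theorem phaseCell_subset : phaseCell ⊆ closedPhaseCell :=
  prod_mono spaceCell_subset Ico_subset_Icc_self

theorem volume_phaseCell_lt_top : volume phaseCell < ⊤ :=
  (measure_mono phaseCell_subset).trans_lt isCompact_closedPhaseCell.measure_lt_top

theorem integral_phaseCell_const (r : ℝ) :
    ∫ _ξ in phaseCell, r = 2 * Real.pi * r := by
  have h : (volume : Measure ((ℝ × ℝ) × ℝ)).real phaseCell = 2 * Real.pi := by
    rw [phaseCell, spaceCell, Measure.volume_eq_prod, measureReal_prod_prod,
      Measure.volume_eq_prod, measureReal_prod_prod]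
    simp [Real.volume_real_Ico, Real.pi_pos.le]
  rw [setIntegral_const, h, smul_eq_mul]

theorem integrableOn_phaseCell_of_continuous {h : (ℝ × ℝ) × ℝ → ℝ} (hh : Continuous h) :
    IntegrableOn h phaseCell :=
  (hh.continuousOn.integrableOn_compact isCompact_closedPhaseCell).mono_set phaseCell_subset

theorem integrableOn_phaseCell_of_bound {h : (ℝ × ℝ) × ℝ → ℝ} (hh : Measurable h) {C : ℝ}
    (hC : ∀ ξ ∈ phaseCell, |h ξ| ≤ C) : IntegrableOn h phaseCell :=
  Measure.integrableOn_of_bounded volume_phaseCell_lt_top.ne hh.aestronglyMeasurable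
    (ae_restrict_of_forall_mem measurableSet_phaseCell hC)

theorem setIntegral_prod_symm {X Y : Type*} [MeasurableSpace X] [MeasurableSpace Y]
    {μ : Measure X} {ν : Measure Y} [SFinite μ] [SFinite ν] {s : Set X} {t : Set Y} (h : X × Y → ℝ)
    (hh : IntegrableOn h (s ×ˢ t) (μ.prod ν)) :
    ∫ z in s ×ˢ t, h z ∂(μ.prod ν) = ∫ y in t, ∫ x in s, h (x, y) ∂μ ∂ν := by
  rw [IntegrableOn, ← Measure.prod_restrict] at hh
  rw [← Measure.prod_restrict, integral_prod_symm _ hh]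

theorem integral_phaseCell_angle {h : (ℝ × ℝ) × ℝ → ℝ} (hh : IntegrableOn h phaseCell) :
    ∫ ξ in phaseCell, h ξ = ∫ x in spaceCell, ∫ θ in Ico 0 (2 * Real.pi), h (x, θ) :=
  setIntegral_prod h hh

theorem integral_phaseCell_iterated {h : (ℝ × ℝ) × ℝ → ℝ} (hh : IntegrableOn h phaseCell) :
    ∫ ξ in phaseCell, h ξ =
      ∫ b in Ico 0 1, ∫ a in Ico 0 1, ∫ θ in Ico 0 (2 * Real.pi), h ((a, b), θ) := by
  rw [integral_phaseCell_angle hh]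
  refine setIntegral_prod_symm (fun x : ℝ × ℝ => ∫ θ in Ico 0 (2 * Real.pi), h (x, θ)) ?_
  have h1 : IntegrableOn h (spaceCell ×ˢ Ico 0 (2 * Real.pi)) (volume.prod volume) := hh
  rw [IntegrableOn, ← Measure.prod_restrict] at h1
  exact h1.integral_prod_left

theorem integrableOn_spaceCell_of_continuous {h : ℝ × ℝ → ℝ} (hh : Continuous h) :
    IntegrableOn h spaceCell :=
  (hh.continuousOn.integrableOn_compact isCompact_closedSpaceCell).mono_set spaceCell_subset

theorem setIntegral_Ico_deriv_eq_zero {P P' : ℝ → ℝ} {L : ℝ} (hL : 0 ≤ L)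
    (hP : ∀ s, HasDerivAt P (P' s) s) (hP' : Continuous P') (hper : P L = P 0) :
    ∫ s in Ico 0 L, P' s = 0 := by
  rw [integral_Ico_eq_integral_Ioc, ← intervalIntegral.integral_of_le hL,
    intervalIntegral.integral_eq_sub_of_hasDerivAt (fun s _ => hP s)
      (hP'.intervalIntegrable _ _), hper, sub_self]

/-- Fubini makes the differentiated variable innermost, and the boundary terms cancel by
periodicity. This and its two analogues are the only integrations by parts needed. -/
theorem integral_phaseCell_deriv_fst_eq_zero {P P' : (ℝ × ℝ) × ℝ → ℝ}
    (hP : ∀ a b θ, HasDerivAt (fun s => P ((s, b), θ)) (P' ((a, b), θ)) a) (hP' : Continuous P')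
    (hper : ∀ b θ, P ((1, b), θ) = P ((0, b), θ)) : ∫ ξ in phaseCell, P' ξ = 0 := by
  have h1 := integrableOn_phaseCell_of_continuous hP'
  refine (setIntegral_prod_symm P' h1).trans ?_
  refine (integral_congr_ae (Eventually.of_forall fun θ => ?_)).trans (integral_zero _ _)
  refine (setIntegral_prod_symm (fun x : ℝ × ℝ => P' (x, θ))
    (integrableOn_spaceCell_of_continuous (by fun_prop))).trans ?_
  refine (integral_congr_ae (Eventually.of_forall fun b => ?_)).trans (integral_zero _ _)
  exact setIntegral_Ico_deriv_eq_zero zero_le_one (fun a => hP a b θ) (by fun_prop) (hper b θ)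

theorem integral_phaseCell_deriv_snd_eq_zero {P P' : (ℝ × ℝ) × ℝ → ℝ}
    (hP : ∀ a b θ, HasDerivAt (fun s => P ((a, s), θ)) (P' ((a, b), θ)) b) (hP' : Continuous P')
    (hper : ∀ a θ, P ((a, 1), θ) = P ((a, 0), θ)) : ∫ ξ in phaseCell, P' ξ = 0 := by
  have h1 := integrableOn_phaseCell_of_continuous hP'
  refine (setIntegral_prod_symm P' h1).trans ?_
  refine (integral_congr_ae (Eventually.of_forall fun θ => ?_)).trans (integral_zero _ _)
  refine (setIntegral_prod (fun x : ℝ × ℝ => P' (x, θ))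
    (integrableOn_spaceCell_of_continuous (by fun_prop))).trans ?_
  refine (integral_congr_ae (Eventually.of_forall fun a => ?_)).trans (integral_zero _ _)
  exact setIntegral_Ico_deriv_eq_zero zero_le_one (fun b => hP a b θ) (by fun_prop) (hper a θ)

theorem integral_phaseCell_deriv_angle_eq_zero {P P' : (ℝ × ℝ) × ℝ → ℝ}
    (hP : ∀ x θ, HasDerivAt (fun s => P (x, s)) (P' (x, θ)) θ) (hP' : Continuous P')
    (hper : ∀ x, P (x, 2 * Real.pi) = P (x, 0)) : ∫ ξ in phaseCell, P' ξ = 0 := by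
  rw [integral_phaseCell_angle (integrableOn_phaseCell_of_continuous hP')]
  refine (integral_congr_ae (Eventually.of_forall fun x => ?_)).trans (integral_zero _ _)
  exact setIntegral_Ico_deriv_eq_zero Real.two_pi_pos.le (fun θ => hP x θ) (by fun_prop) (hper x)

/-! ### The logarithmic Sobolev inequality on the cell -/

/-- A one-dimensional logarithmic Sobolev inequality on an interval, from the oscillation bound and
the comparison of entropy with variance. -/
theorem entropy_Ico_le {g g' : ℝ → ℝ} {L K : ℝ} (hL : 0 < L) (hK : 0 ≤ K)
    (hg : ∀ s, HasDerivAt g (g' s) s) (hg' : Continuous g') (h0 : ∀ s, 0 ≤ g s)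
    (hle : (∫ s in Ico 0 L, |g' s|) ^ 2 ≤ K * ∫ s in Ico 0 L, g s) :
    (∫ s in Ico 0 L, g s * Real.log (g s)) -
      (∫ s in Ico 0 L, g s) * Real.log ((∫ s in Ico 0 L, g s) / L) ≤ L ^ 2 * K := by
  have hgc : Continuous g := continuous_iff_continuousAt.2 fun s => (hg s).continuousAt
  have hint : ∀ {k : ℝ → ℝ}, Continuous k → IntegrableOn k (Ico 0 L) := fun hk =>
    (hk.continuousOn.integrableOn_compact isCompact_Icc).mono_set Ico_subset_Icc_self
  have hconst : ∀ r : ℝ, ∫ _s in Ico 0 L, r = L * r := fun r => by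
    simp [Real.volume_real_Ico, hL.le]
  set D := ∫ s in Ico 0 L, |g' s| with hD
  set M := ∫ s in Ico 0 L, g s with hM
  have hM0 : 0 ≤ M := integral_nonneg h0
  -- The oscillation is at most the total variation `D`; averaging over `y` then places `g` within
  -- `D` of its mean `m`.
  have hosc : ∀ x ∈ Ico 0 L, ∀ y ∈ Ico 0 L, g x - g y ≤ D := by
    intro x hx y hy
    rw [← intervalIntegral.integral_eq_sub_of_hasDerivAt (fun s _ => hg s)
      (hg'.intervalIntegrable _ _)]
    refine (le_abs_self _).trans ?_
    rw [← Real.norm_eq_abs]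
    refine intervalIntegral.norm_integral_le_integral_norm_uIoc.trans ?_
    refine setIntegral_mono_set (hint hg'.abs) (Eventually.of_forall fun s => abs_nonneg _) ?_
    refine LE.le.eventuallyLE fun s hs => ?_
    exact ⟨(le_min hy.1 hx.1).trans hs.1.le, hs.2.trans_lt (max_lt hy.2 hx.2)⟩
  rcases hM0.eq_or_lt with hM1 | hM1
  · have h1 : g =ᵐ[volume.restrict (Ico 0 L)] 0 :=
      (setIntegral_eq_zero_iff_of_nonneg_ae (Eventually.of_forall h0) (hint hgc)).1 hM1.symm
    have h2 : ∫ s in Ico 0 L, g s * Real.log (g s) = 0 := by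
      refine integral_eq_zero_of_ae ?_
      filter_upwards [h1] with s hs
      simp [hs]
    rw [h2, ← hM1]
    simp only [zero_mul, sub_zero]
    positivity
  set m := M / L with hm
  have hm0 : 0 < m := by positivity
  have hMm : M = L * m := by rw [hm]; field_simp
  have hdev : ∀ x ∈ Ico 0 L, (g x - m) ^ 2 ≤ D ^ 2 := by
    intro x hx
    have h1 : L * (g x - D) ≤ M := by
      rw [← hconst]
      exact setIntegral_mono_on (hint continuous_const) (hint hgc) measurableSet_Ico
        fun y hy => by linarith [hosc x hx y hy]
    have h2 : M ≤ L * (g x + D) := by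
      rw [← hconst]
      exact setIntegral_mono_on (hint hgc) (hint continuous_const) measurableSet_Ico
        fun y hy => by linarith [hosc y hy x hx]
    rw [hMm] at h1 h2
    have h1 := le_of_mul_le_mul_left h1 hL
    have h2 := le_of_mul_le_mul_left h2 hL
    exact sq_le_sq' (by linarith) (by linarith)
  -- This uses `log z ≤ z - 1` at `z = g x / m`. The linear term `g x - m` integrates to zero.
  have hpt : ∀ x ∈ Ico 0 L,
      g x * Real.log (g x) ≤ g x * Real.log m + (D ^ 2 / m + (g x - m)) := by
    intro x hx
    have h1 : g x * Real.log (g x) - g x * Real.log m ≤ (g x - m) ^ 2 / m + (g x - m) := by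
      rcases (h0 x).eq_or_lt with h2 | h2
      · rw [← h2]; simp only [zero_mul, sub_zero, zero_sub, neg_sq]
        rw [sq, mul_div_assoc, div_self hm0.ne']; simp
      · have h3 := Real.log_le_sub_one_of_pos (div_pos h2 hm0)
        rw [Real.log_div h2.ne' hm0.ne'] at h3
        calc _ = g x * (Real.log (g x) - Real.log m) := by ring
          _ ≤ g x * (g x / m - 1) := mul_le_mul_of_nonneg_left h3 h2.le
          _ = _ := by field_simp; ring
    have h2 := div_le_div_of_nonneg_right (hdev x hx) hm0.le
    linarith
  have h1 : ∫ s in Ico 0 L, g s * Real.log (g s) ≤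
      ∫ s in Ico 0 L, (g s * Real.log m + (D ^ 2 / m + (g s - m))) :=
    setIntegral_mono_on (hint (Real.continuous_mul_log.comp hgc)) (hint (by fun_prop))
      measurableSet_Ico hpt
  rw [integral_add (hint (by fun_prop)) (hint (by fun_prop)),
    integral_add (hint (by fun_prop)) (hint (by fun_prop)),
    integral_sub (hint hgc) (hint (by fun_prop)), integral_mul_const, hconst, hconst, ← hM] at h1
  -- The mean in the denominator cancels the mass `L * m` in `D ^ 2 ≤ K * M`.
  have h2 : L * (D ^ 2 / m) ≤ L ^ 2 * K := by
    rw [← mul_div_assoc, div_le_iff₀ hm0]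
    calc L * D ^ 2 ≤ L * (K * M) := by gcongr
      _ = _ := by rw [hMm]; ring
  linarith

/-- Continuity of the integral over a bounded set of a jointly continuous function. -/
theorem continuous_setIntegral_of_continuous {X Y : Type*} [PseudoMetricSpace X] [ProperSpace X]
    [TopologicalSpace Y] [SecondCountableTopology Y]
    [MeasurableSpace Y] [OpensMeasurableSpace Y] {μ : Measure Y}
    [IsFiniteMeasureOnCompacts μ] {s K : Set Y} (hs : MeasurableSet s) (hK : IsCompact K)
    (hsK : s ⊆ K) {k : X → Y → ℝ} (hk : Continuous (Function.uncurry k)) :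
    Continuous fun a => ∫ y in s, k a y ∂μ := by
  refine continuous_iff_continuousAt.2 fun a => ?_
  obtain ⟨C, hC⟩ := ((isCompact_closedBall a (1 : ℝ)).prod hK).exists_bound_of_continuousOn
    hk.continuousOn
  have hc : ∀ a, Continuous (k a) := fun a => hk.comp (by fun_prop : Continuous fun y => (a, y))
  have hfin : IntegrableOn (fun _ => C) s μ :=
    integrableOn_const ((measure_mono hsK).trans_lt hK.measure_lt_top).ne
  refine continuousAt_of_dominated (bound := fun _ => C)
    (Eventually.of_forall fun a => (hc a).aestronglyMeasurable) ?_ hfin ?_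
  · filter_upwards [Metric.closedBall_mem_nhds a one_pos] with x hx
    exact ae_restrict_of_forall_mem hs fun y hy => hC (x, y) ⟨hx, hsK hy⟩
  · exact Eventually.of_forall fun y =>
      (hk.comp (by fun_prop : Continuous fun x => (x, y))).continuousAt

/-- Differentiation of the integral over a bounded set of a jointly `C¹` function. -/
theorem hasDerivAt_setIntegral_of_contDiff {Y : Type*} [NormedAddCommGroup Y] [NormedSpace ℝ Y]
    [FiniteDimensional ℝ Y] [MeasurableSpace Y] [BorelSpace Y] {μ : Measure Y}
    [IsFiniteMeasureOnCompacts μ] {s K : Set Y} (hs : MeasurableSet s) (hK : IsCompact K)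
    (hsK : s ⊆ K) {F F' : ℝ → Y → ℝ} (hF : Continuous (Function.uncurry F))
    (hF' : Continuous (Function.uncurry F')) (hd : ∀ a y, HasDerivAt (F · y) (F' a y) a) (a : ℝ) :
    HasDerivAt (fun a => ∫ y in s, F a y ∂μ) (∫ y in s, F' a y ∂μ) a := by
  obtain ⟨C, hC⟩ := ((isCompact_closedBall a (1 : ℝ)).prod hK).exists_bound_of_continuousOn
    hF'.continuousOn
  have hc : ∀ {k : ℝ → Y → ℝ}, Continuous (Function.uncurry k) → ∀ a, Continuous (k a) :=
    fun hk a => hk.comp (by fun_prop : Continuous fun y => (a, y))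
  have hint : ∀ {k : Y → ℝ}, Continuous k → IntegrableOn k s μ := fun hk =>
    (hk.continuousOn.integrableOn_compact hK).mono_set hsK
  refine (hasDerivAt_integral_of_dominated_loc_of_deriv_le (bound := fun _ => C)
    (Metric.closedBall_mem_nhds a one_pos)
    (Eventually.of_forall fun a => (hint (hc hF a)).aestronglyMeasurable) (hint (hc hF a))
    (hint (hc hF' a)).aestronglyMeasurable
    (ae_restrict_of_forall_mem hs fun y hy x hx => hC (x, y) ⟨hx, hsK hy⟩)
    (hint continuous_const) (Eventually.of_forall fun y x _ => hd x y)).2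

/-- The logarithmic Sobolev inequality for a marginal density. -/
theorem entropy_marginal_le {Y : Type*} [NormedAddCommGroup Y] [NormedSpace ℝ Y]
    [FiniteDimensional ℝ Y] [MeasurableSpace Y] [BorelSpace Y] {μ : Measure Y}
    [IsFiniteMeasureOnCompacts μ] [SFinite μ] {s K : Set Y} (hs : MeasurableSet s)
    (hK : IsCompact K) (hsK : s ⊆ K) {L : ℝ} (hL : 0 < L) {F F' q : ℝ → Y → ℝ}
    (hF : Continuous (Function.uncurry F)) (hF' : Continuous (Function.uncurry F'))
    (hd : ∀ a y, HasDerivAt (F · y) (F' a y) a) (h0 : ∀ a y, 0 ≤ F a y)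
    (hq : IntegrableOn (Function.uncurry q) (Ico 0 L ×ˢ s) (volume.prod μ))
    (hq0 : ∀ a y, 0 ≤ q a y)
    (hle : ∀ a ∈ Ico 0 L, ∀ y ∈ s, F' a y ^ 2 ≤ q a y * F a y) :
    (∫ a in Ico 0 L, (∫ y in s, F a y ∂μ) * Real.log (∫ y in s, F a y ∂μ)) -
      (∫ a in Ico 0 L, ∫ y in s, F a y ∂μ) *
        Real.log ((∫ a in Ico 0 L, ∫ y in s, F a y ∂μ) / L) ≤
      L ^ 2 * ∫ a in Ico 0 L, ∫ y in s, q a y ∂μ := by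
  have hsub : Ico 0 L ×ˢ s ⊆ Icc 0 L ×ˢ K := prod_mono Ico_subset_Icc_self hsK
  have hint : ∀ {k : ℝ → Y → ℝ}, Continuous (Function.uncurry k) →
      IntegrableOn (Function.uncurry k) (Ico 0 L ×ˢ s) (volume.prod μ) := fun hk =>
    (hk.continuousOn.integrableOn_compact (isCompact_Icc.prod hK)).mono_set hsub
  have hcont : ∀ {k : ℝ → Y → ℝ}, Continuous (Function.uncurry k) →
      Continuous fun a => ∫ y in s, k a y ∂μ := fun hk =>
    continuous_setIntegral_of_continuous hs hK hsK hk
  have hm : MeasurableSet (Ico 0 L ×ˢ s) := measurableSet_Ico.prod hs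
  -- Cauchy–Schwarz is applied on the whole product, before taking marginals: the marginal's
  -- derivative is `∫ F'`, whose `L¹` norm is at most that of `F'`. The Fisher information of the
  -- marginal itself is never needed.
  have hCS := sq_integral_abs_le (μ := (volume.prod μ).restrict (Ico 0 L ×ˢ s)) hq (hint hF)
    (hint hF') (Eventually.of_forall fun z => hq0 z.1 z.2)
    (Eventually.of_forall fun z => h0 z.1 z.2)
    (ae_restrict_of_forall_mem hm fun z hz => hle z.1 hz.1 z.2 hz.2)
  have hF'abs : Continuous (Function.uncurry fun a y => |F' a y|) := hF'.abs
  rw [setIntegral_prod _ hq, setIntegral_prod _ (hint hF),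
    setIntegral_prod (fun z : ℝ × Y => |Function.uncurry F' z|) (hint hF'abs)] at hCS
  simp only [Function.uncurry_apply_pair] at hCS
  refine entropy_Ico_le hL (integral_nonneg fun a => integral_nonneg fun y => hq0 a y)
    (fun a => hasDerivAt_setIntegral_of_contDiff hs hK hsK hF hF' hd a) (hcont hF')
    (fun a => integral_nonneg (h0 a)) (le_trans ?_ hCS)
  have hint' : ∀ {k : ℝ → ℝ}, Continuous k → IntegrableOn k (Ico 0 L) := fun hk =>
    (hk.continuousOn.integrableOn_compact isCompact_Icc).mono_set Ico_subset_Icc_self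
  refine pow_le_pow_left₀ (integral_nonneg fun a => abs_nonneg _) ?_ 2
  exact setIntegral_mono_on (hint' (hcont hF').abs) (hint' (hcont hF'abs)) measurableSet_Ico
    fun a _ => abs_integral_le_integral_abs

/-! ### Coordinate derivatives on the phase space -/

/-- The derivative of `G` in the first space variable. -/
noncomputable def pd₁ (G : (ℝ × ℝ) × ℝ → ℝ) (ξ : (ℝ × ℝ) × ℝ) : ℝ := fderiv ℝ G ξ ((1, 0), 0)

/-- The derivative of `G` in the second space variable. -/
noncomputable def pd₂ (G : (ℝ × ℝ) × ℝ → ℝ) (ξ : (ℝ × ℝ) × ℝ) : ℝ := fderiv ℝ G ξ ((0, 1), 0)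

/-- The derivative of `G` in the angle. -/
noncomputable def pd₃ (G : (ℝ × ℝ) × ℝ → ℝ) (ξ : (ℝ × ℝ) × ℝ) : ℝ := fderiv ℝ G ξ ((0, 0), 1)

section CoordinateDerivatives

variable {G : (ℝ × ℝ) × ℝ → ℝ}

theorem hasDerivAt_pd₁ (hG : Differentiable ℝ G) (a b θ : ℝ) :
    HasDerivAt (fun s => G ((s, b), θ)) (pd₁ G ((a, b), θ)) a :=
  (hG ((a, b), θ)).hasFDerivAt.comp_hasDerivAt a
    (((hasDerivAt_id a).prodMk (hasDerivAt_const a b)).prodMk (hasDerivAt_const a θ))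

theorem hasDerivAt_pd₂ (hG : Differentiable ℝ G) (a b θ : ℝ) :
    HasDerivAt (fun s => G ((a, s), θ)) (pd₂ G ((a, b), θ)) b :=
  (hG ((a, b), θ)).hasFDerivAt.comp_hasDerivAt b
    (((hasDerivAt_const b a).prodMk (hasDerivAt_id b)).prodMk (hasDerivAt_const b θ))

theorem hasDerivAt_pd₃ (hG : Differentiable ℝ G) (x : ℝ × ℝ) (θ : ℝ) :
    HasDerivAt (fun s => G (x, s)) (pd₃ G (x, θ)) θ :=
  (hG (x, θ)).hasFDerivAt.comp_hasDerivAt θ ((hasDerivAt_const θ x).prodMk (hasDerivAt_id θ))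

theorem contDiff_fderiv_apply_const {n : ℕ} (hG : ContDiff ℝ (n + 1 : ℕ) G) (v : (ℝ × ℝ) × ℝ) :
    ContDiff ℝ n fun ξ => fderiv ℝ G ξ v := by
  have hG : ContDiff ℝ ((n : WithTop ℕ∞) + 1) G := by exact_mod_cast hG
  exact (contDiff_succ_iff_fderiv.1 hG).2.2.clm_apply contDiff_const

theorem contDiff_pd₁ {n : ℕ} (hG : ContDiff ℝ (n + 1 : ℕ) G) : ContDiff ℝ n (pd₁ G) :=
  contDiff_fderiv_apply_const hG _

theorem contDiff_pd₂ {n : ℕ} (hG : ContDiff ℝ (n + 1 : ℕ) G) : ContDiff ℝ n (pd₂ G) :=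
  contDiff_fderiv_apply_const hG _

theorem contDiff_pd₃ {n : ℕ} (hG : ContDiff ℝ (n + 1 : ℕ) G) : ContDiff ℝ n (pd₃ G) :=
  contDiff_fderiv_apply_const hG _

theorem spaceGrad_eq_pd {g : ℝ × ℝ → ℝ → ℝ}
    (hg : Differentiable ℝ fun ξ : (ℝ × ℝ) × ℝ => g ξ.1 ξ.2) (x : ℝ × ℝ) (θ : ℝ) :
    spaceGrad (fun z => g z θ) x =
      (pd₁ (fun ξ => g ξ.1 ξ.2) (x, θ), pd₂ (fun ξ => g ξ.1 ξ.2) (x, θ)) :=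
  Prod.ext (hasDerivAt_pd₁ hg x.1 x.2 θ).deriv (hasDerivAt_pd₂ hg x.1 x.2 θ).deriv

theorem deriv_eq_pd₃ {g : ℝ × ℝ → ℝ → ℝ}
    (hg : Differentiable ℝ fun ξ : (ℝ × ℝ) × ℝ => g ξ.1 ξ.2) (x : ℝ × ℝ) (θ : ℝ) :
    deriv (fun a => g x a) θ = pd₃ (fun ξ => g ξ.1 ξ.2) (x, θ) :=
  (hasDerivAt_pd₃ hg x θ).deriv

/-- Serves both to bound the Fisher density on the cell and to make the gradient vanish at zeros of
`G`, so that Lean's `0 / 0 = 0` is the intended value there. -/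
theorem exists_sq_pd_le (hG : ContDiff ℝ 2 G) (h0 : ∀ ξ, 0 ≤ G ξ) :
    ∃ C, 0 ≤ C ∧ ∀ ξ ∈ closedPhaseCell, pd₁ G ξ ^ 2 ≤ C * G ξ ∧ pd₂ G ξ ^ 2 ≤ C * G ξ ∧
      pd₃ G ξ ^ 2 ≤ C * G ξ := by
  have key := exists_sq_fderiv_le isOpen_univ hG.contDiffOn (fun x _ => h0 x)
    isCompact_closedPhaseCell (subset_univ _)
  obtain ⟨C1, hC1, h1⟩ := key ((1, 0), 0)
  obtain ⟨C2, hC2, h2⟩ := key ((0, 1), 0)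
  obtain ⟨C3, hC3, h3⟩ := key ((0, 0), 1)
  refine ⟨C1 + C2 + C3, by positivity, fun ξ hξ => ⟨(h1 ξ hξ).trans ?_, (h2 ξ hξ).trans ?_,
    (h3 ξ hξ).trans ?_⟩⟩ <;>
  · refine mul_le_mul_of_nonneg_right ?_ (h0 ξ)
    linarith

/-! ### The Fisher information -/

theorem sq_div_le_of_sq_le {a g C : ℝ} (hC : 0 ≤ C) (hg : 0 ≤ g) (h : a ^ 2 ≤ C * g) :
    |a ^ 2 / g| ≤ C := by
  rw [abs_of_nonneg (by positivity)]
  exact div_le_of_le_mul₀ hg hC h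

theorem sq_le_sq_div_mul {a g C : ℝ} (h : a ^ 2 ≤ C * g) : a ^ 2 ≤ a ^ 2 / g * g := by
  rcases eq_or_ne g 0 with rfl | h1
  · simpa using h
  · rw [div_mul_cancel₀ _ h1]

theorem fisherDensity_eq_pd {g : ℝ × ℝ → ℝ → ℝ}
    (hg : Differentiable ℝ fun ξ : (ℝ × ℝ) × ℝ => g ξ.1 ξ.2) (ξ : (ℝ × ℝ) × ℝ) :
    fisherDensity g ξ.1 ξ.2 = pd₁ (fun ξ => g ξ.1 ξ.2) ξ ^ 2 / g ξ.1 ξ.2 +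
      pd₂ (fun ξ => g ξ.1 ξ.2) ξ ^ 2 / g ξ.1 ξ.2 + pd₃ (fun ξ => g ξ.1 ξ.2) ξ ^ 2 / g ξ.1 ξ.2 := by
  rw [fisherDensity, spaceGrad_eq_pd hg, deriv_eq_pd₃ hg, dot]
  ring

theorem integrableOn_sq_div (hG : Continuous G) {p : (ℝ × ℝ) × ℝ → ℝ} (hp : Continuous p) {C : ℝ}
    (hC : 0 ≤ C) (h0 : ∀ ξ, 0 ≤ G ξ) (h : ∀ ξ ∈ closedPhaseCell, p ξ ^ 2 ≤ C * G ξ) :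
    IntegrableOn (fun ξ => p ξ ^ 2 / G ξ) phaseCell :=
  integrableOn_phaseCell_of_bound ((hp.measurable.pow_const 2).div hG.measurable)
    fun ξ hξ => sq_div_le_of_sq_le hC (h0 ξ) (h ξ (phaseCell_subset hξ))

end CoordinateDerivatives

theorem integrableOn_fisherDensity {g : ℝ × ℝ → ℝ → ℝ}
    (hg : ContDiff ℝ 2 fun ξ : (ℝ × ℝ) × ℝ => g ξ.1 ξ.2) (h0 : ∀ x θ, 0 ≤ g x θ) :
    IntegrableOn (fun ξ : (ℝ × ℝ) × ℝ => fisherDensity g ξ.1 ξ.2) phaseCell := by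
  obtain ⟨C, hC, h⟩ := exists_sq_pd_le hg fun ξ => h0 ξ.1 ξ.2
  simp_rw [fisherDensity_eq_pd (hg.differentiable (by norm_num))]
  have h1 := integrableOn_sq_div hg.continuous (contDiff_pd₁ (n := 1) hg).continuous hC
    (fun ξ => h0 ξ.1 ξ.2) fun ξ hξ => (h ξ hξ).1
  have h2 := integrableOn_sq_div hg.continuous (contDiff_pd₂ (n := 1) hg).continuous hC
    (fun ξ => h0 ξ.1 ξ.2) fun ξ hξ => (h ξ hξ).2.1
  have h3 := integrableOn_sq_div hg.continuous (contDiff_pd₃ (n := 1) hg).continuous hC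
    (fun ξ => h0 ξ.1 ξ.2) fun ξ hξ => (h ξ hξ).2.2
  exact (h1.add h2).add h3

/-- The logarithmic Sobolev inequality on the phase cell. -/
theorem entropy_phaseCell_le {g : ℝ × ℝ → ℝ → ℝ}
    (hg : ContDiff ℝ 2 fun ξ : (ℝ × ℝ) × ℝ => g ξ.1 ξ.2) (h0 : ∀ x θ, 0 ≤ g x θ) :
    (phaseIntegral fun x θ => g x θ * Real.log (g x θ)) -
      phaseIntegral g * Real.log (phaseIntegral g / (2 * Real.pi)) ≤
      4 * Real.pi ^ 2 * fisherInfo g := by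
  have hpi := Real.pi_pos
  set G : (ℝ × ℝ) × ℝ → ℝ := fun ξ => g ξ.1 ξ.2 with hGdef
  have hG0 : ∀ ξ, 0 ≤ G ξ := fun ξ => h0 ξ.1 ξ.2
  have hGd : Differentiable ℝ G := hg.differentiable (by norm_num)
  have hGc : Continuous G := hg.continuous
  have hc1 : Continuous (pd₁ G) := (contDiff_pd₁ (n := 1) hg).continuous
  have hc2 : Continuous (pd₂ G) := (contDiff_pd₂ (n := 1) hg).continuous
  have hc3 : Continuous (pd₃ G) := (contDiff_pd₃ (n := 1) hg).continuous
  obtain ⟨C, hC, hbd⟩ := exists_sq_pd_le hg hG0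
  have hi1 := integrableOn_sq_div hGc hc1 hC hG0 fun ξ hξ => (hbd ξ hξ).1
  have hi2 := integrableOn_sq_div hGc hc2 hC hG0 fun ξ hξ => (hbd ξ hξ).2.1
  have hi3 := integrableOn_sq_div hGc hc3 hC hG0 fun ξ hξ => (hbd ξ hξ).2.2
  have hm1 : Measurable fun ξ => pd₁ G ξ ^ 2 / G ξ :=
    (hc1.measurable.pow_const 2).div hGc.measurable
  have hm2 : Measurable fun ξ => pd₂ G ξ ^ 2 / G ξ :=
    (hc2.measurable.pow_const 2).div hGc.measurable
  have hm3 : Measurable fun ξ => pd₃ G ξ ^ 2 / G ξ :=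
    (hc3.measurable.pow_const 2).div hGc.measurable
  have hfin2 : volume (Ico (0 : ℝ) 1 ×ˢ Ico 0 (2 * Real.pi)) ≠ ⊤ :=
    ((measure_mono (Set.prod_mono Ico_subset_Icc_self Ico_subset_Icc_self)).trans_lt
      (isCompact_Icc.prod isCompact_Icc).measure_lt_top).ne
  set J := Ico 0 (2 * Real.pi) with hJ
  set ρ : ℝ × ℝ → ℝ := fun x => ∫ θ in J, G (x, θ) with hρ
  set σ : ℝ → ℝ := fun b => ∫ a in Ico 0 1, ρ (a, b) with hσ
  have hρc : Continuous ρ := continuous_setIntegral_of_continuous measurableSet_Ico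
    isCompact_Icc Ico_subset_Icc_self (k := fun x θ => G (x, θ)) hGc
  have hσc : Continuous σ := continuous_setIntegral_of_continuous measurableSet_Ico
    isCompact_Icc Ico_subset_Icc_self (k := fun b a => ρ (a, b))
    (hρc.comp (by fun_prop : Continuous fun p : ℝ × ℝ => (p.2, p.1)))
  have hM : phaseIntegral g = ∫ b in Ico 0 1, σ b :=
    integral_phaseCell_iterated (integrableOn_phaseCell_of_continuous hGc)
  have hM' : phaseIntegral g = ∫ x in spaceCell, ρ x :=
    integral_phaseCell_angle (integrableOn_phaseCell_of_continuous hGc)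
  -- the angle
  have hA3 : ∀ x ∈ spaceCell, (∫ θ in J, G (x, θ) * Real.log (G (x, θ))) ≤
      ρ x * Real.log (ρ x) - ρ x * Real.log (2 * Real.pi) +
        (2 * Real.pi) ^ 2 * ∫ θ in J, pd₃ G (x, θ) ^ 2 / G (x, θ) := by
    intro x hx
    have hcell : ∀ θ ∈ J, (x, θ) ∈ closedPhaseCell := fun θ hθ => phaseCell_subset ⟨hx, hθ⟩
    have hint : ∀ {k : ℝ → ℝ}, Continuous k → IntegrableOn k J := fun hk =>
      (hk.continuousOn.integrableOn_compact isCompact_Icc).mono_set Ico_subset_Icc_self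
    have hq : IntegrableOn (fun θ => pd₃ G (x, θ) ^ 2 / G (x, θ)) J :=
      Measure.integrableOn_of_bounded (by rw [hJ, Real.volume_Ico]; exact ENNReal.ofReal_ne_top)
        (hm3.comp measurable_prodMk_left).aestronglyMeasurable
        (ae_restrict_of_forall_mem measurableSet_Ico
          fun θ hθ => sq_div_le_of_sq_le hC (hG0 _) (hbd _ (hcell θ hθ)).2.2)
    have hCS := sq_integral_abs_le (μ := volume.restrict J) hq
      (hint (by fun_prop : Continuous fun θ => G (x, θ)))
      (hint (by fun_prop : Continuous fun θ => pd₃ G (x, θ)))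
      (Eventually.of_forall fun θ => div_nonneg (sq_nonneg _) (hG0 _))
      (Eventually.of_forall fun θ => hG0 _)
      (ae_restrict_of_forall_mem measurableSet_Ico
        fun θ hθ => sq_le_sq_div_mul (hbd _ (hcell θ hθ)).2.2)
    have := entropy_Ico_le Real.two_pi_pos
      (integral_nonneg fun θ => div_nonneg (sq_nonneg _) (hG0 (x, θ)))
      (hasDerivAt_pd₃ hGd x) (by fun_prop) (fun θ => hG0 (x, θ)) hCS
    have h2 : ρ x * Real.log (ρ x / (2 * Real.pi)) =
        ρ x * Real.log (ρ x) - ρ x * Real.log (2 * Real.pi) := by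
      rcases eq_or_ne (ρ x) 0 with h | h
      · simp [h]
      · rw [Real.log_div h Real.two_pi_pos.ne']; ring
    change _ - ρ x * Real.log (ρ x / (2 * Real.pi)) ≤ _ at this
    linarith
  have hρlog : Continuous fun x => ρ x * Real.log (ρ x) := Real.continuous_mul_log.comp hρc
  have hleft : ∀ {h : (ℝ × ℝ) × ℝ → ℝ}, IntegrableOn h phaseCell →
      IntegrableOn (fun x => ∫ θ in J, h (x, θ)) spaceCell := by
    intro h hh
    have h1 : IntegrableOn h (spaceCell ×ˢ J) (volume.prod volume) := hh
    rw [IntegrableOn, ← Measure.prod_restrict] at h1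
    exact h1.integral_prod_left
  have hB3 : (∫ ξ in phaseCell, G ξ * Real.log (G ξ)) ≤
      (∫ x in spaceCell, ρ x * Real.log (ρ x)) - phaseIntegral g * Real.log (2 * Real.pi) +
        (2 * Real.pi) ^ 2 * ∫ ξ in phaseCell, pd₃ G ξ ^ 2 / G ξ := by
    have hGl : IntegrableOn (fun ξ => G ξ * Real.log (G ξ)) phaseCell :=
      integrableOn_phaseCell_of_continuous (Real.continuous_mul_log.comp hGc)
    have i1 := integrableOn_spaceCell_of_continuous hρlog
    have i2 : IntegrableOn (fun x => ρ x * Real.log (2 * Real.pi)) spaceCell :=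
      integrableOn_spaceCell_of_continuous (hρc.mul continuous_const)
    have i3 := (hleft hi3).const_mul ((2 * Real.pi) ^ 2)
    have i12 : IntegrableOn (fun x => ρ x * Real.log (ρ x) - ρ x * Real.log (2 * Real.pi))
      spaceCell := i1.sub i2
    rw [integral_phaseCell_angle hGl, integral_phaseCell_angle hi3, hM', ← integral_const_mul,
      ← integral_mul_const, ← integral_sub i1 i2, ← integral_add i12 i3]
    exact setIntegral_mono_on (hleft hGl) (i12.add i3) measurableSet_spaceCell hA3
  -- the first space variable
  have hB1 : (∫ x in spaceCell, ρ x * Real.log (ρ x)) ≤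
      (∫ b in Ico 0 1, σ b * Real.log (σ b)) + ∫ ξ in phaseCell, pd₁ G ξ ^ 2 / G ξ := by
    -- For fixed `b`, the function `a ↦ ρ (a, b)` is the `θ`-marginal of a slice of `G`, on an
    -- interval of length `1`.
    have hA1 : ∀ b ∈ Ico (0 : ℝ) 1, (∫ a in Ico 0 1, ρ (a, b) * Real.log (ρ (a, b))) ≤
        σ b * Real.log (σ b) + ∫ a in Ico 0 1, ∫ θ in J, pd₁ G ((a, b), θ) ^ 2 / G ((a, b), θ) := by
      intro b hb
      have hcell : ∀ a ∈ Ico (0 : ℝ) 1, ∀ θ ∈ J, ((a, b), θ) ∈ closedPhaseCell :=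
        fun a ha θ hθ => phaseCell_subset ⟨⟨ha, hb⟩, hθ⟩
      have := entropy_marginal_le (μ := volume) measurableSet_Ico isCompact_Icc
        Ico_subset_Icc_self one_pos (F := fun a θ => G ((a, b), θ))
        (F' := fun a θ => pd₁ G ((a, b), θ))
        (q := fun a θ => pd₁ G ((a, b), θ) ^ 2 / G ((a, b), θ)) (s := J)
        (by simp only [Function.uncurry_def]; fun_prop)
        (by simp only [Function.uncurry_def]; fun_prop)
        (fun a θ => hasDerivAt_pd₁ hGd a b θ) (fun a θ => hG0 _)
        (Measure.integrableOn_of_bounded hfin2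
          (hm1.comp (by fun_prop : Measurable fun p : ℝ × ℝ =>
            ((p.1, b), p.2))).aestronglyMeasurable
          (ae_restrict_of_forall_mem (measurableSet_Ico.prod measurableSet_Ico) fun p hp =>
            sq_div_le_of_sq_le hC (hG0 _) (hbd _ (hcell _ hp.1 _ hp.2)).1))
        (fun a θ => div_nonneg (sq_nonneg _) (hG0 _))
        (fun a ha θ hθ => sq_le_sq_div_mul (hbd _ (hcell a ha θ hθ)).1)
      change _ - σ b * Real.log (σ b / 1) ≤ _ at this
      rw [div_one, one_pow, one_mul] at this
      linarith
    have hint : ∀ {k : ℝ → ℝ}, Continuous k → IntegrableOn k (Ico 0 1) := fun hk =>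
      (hk.continuousOn.integrableOn_compact isCompact_Icc).mono_set Ico_subset_Icc_self
    have hσlog : Continuous fun b => σ b * Real.log (σ b) := Real.continuous_mul_log.comp hσc
    have hright : ∀ {h : ℝ × ℝ → ℝ}, IntegrableOn h spaceCell →
        IntegrableOn (fun b => ∫ a in Ico 0 1, h (a, b)) (Ico 0 1) := by
      intro h hh
      have h1 : IntegrableOn h (Ico 0 1 ×ˢ Ico 0 1) (volume.prod volume) := hh
      rw [IntegrableOn, ← Measure.prod_restrict] at h1
      exact h1.integral_prod_right
    have hρi := integrableOn_spaceCell_of_continuous hρlog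
    have i3 := hright (hleft hi1)
    rw [integral_phaseCell_iterated hi1, ← integral_add (hint hσlog) i3]
    refine (setIntegral_prod_symm _ hρi).trans_le ?_
    exact setIntegral_mono_on (hright hρi) ((hint hσlog).add i3) measurableSet_Ico hA1
  -- the second space variable
  have hB2 : (∫ b in Ico 0 1, σ b * Real.log (σ b)) ≤
      phaseIntegral g * Real.log (phaseIntegral g) + ∫ ξ in phaseCell, pd₂ G ξ ^ 2 / G ξ := by
    have hcell : ∀ b ∈ Ico (0 : ℝ) 1, ∀ p ∈ Ico (0 : ℝ) 1 ×ˢ J,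
        ((p.1, b), p.2) ∈ closedPhaseCell :=
      fun b hb p hp => phaseCell_subset ⟨⟨hp.1, hb⟩, hp.2⟩
    have hK : IsCompact (Icc (0 : ℝ) 1 ×ˢ Icc 0 (2 * Real.pi)) := isCompact_Icc.prod isCompact_Icc
    have hJm : MeasurableSet (Ico (0 : ℝ) 1 ×ˢ J) := measurableSet_Ico.prod measurableSet_Ico
    have hJK : Ico (0 : ℝ) 1 ×ˢ J ⊆ Icc (0 : ℝ) 1 ×ˢ Icc 0 (2 * Real.pi) :=
      prod_mono Ico_subset_Icc_self Ico_subset_Icc_self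
    have hbd2 : ∀ z ∈ Ico (0 : ℝ) 1 ×ˢ (Ico (0 : ℝ) 1 ×ˢ J),
        |pd₂ G ((z.2.1, z.1), z.2.2) ^ 2 / G ((z.2.1, z.1), z.2.2)| ≤ C := fun z hz =>
      sq_div_le_of_sq_le hC (hG0 _) (hbd _ (hcell z.1 hz.1 z.2 hz.2)).2.1
    have hfin3 : volume (Ico (0 : ℝ) 1 ×ˢ (Ico (0 : ℝ) 1 ×ˢ J)) ≠ ⊤ :=
      ((measure_mono (Set.prod_mono Ico_subset_Icc_self hJK)).trans_lt
        (isCompact_Icc.prod hK).measure_lt_top).ne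
    have := entropy_marginal_le (μ := volume) hJm hK hJK one_pos
      (F := fun b p => G ((p.1, b), p.2)) (F' := fun b p => pd₂ G ((p.1, b), p.2))
      (q := fun b p => pd₂ G ((p.1, b), p.2) ^ 2 / G ((p.1, b), p.2))
      (by simp only [Function.uncurry_def]; fun_prop)
      (by simp only [Function.uncurry_def]; fun_prop)
      (fun b p => hasDerivAt_pd₂ hGd p.1 b p.2) (fun b p => hG0 _)
      (Measure.integrableOn_of_bounded hfin3
        (hm2.comp (by fun_prop : Measurable fun z : ℝ × ℝ × ℝ =>
          ((z.2.1, z.1), z.2.2))).aestronglyMeasurable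
        (ae_restrict_of_forall_mem (measurableSet_Ico.prod hJm) hbd2))
      (fun b p => div_nonneg (sq_nonneg _) (hG0 _))
      (fun b hb p hp => sq_le_sq_div_mul (hbd _ (hcell b hb p hp)).2.1)
    have hσ' : ∀ b, ∫ p in Ico (0 : ℝ) 1 ×ˢ J, G ((p.1, b), p.2) = σ b := fun b =>
      setIntegral_prod (fun p : ℝ × ℝ => G ((p.1, b), p.2))
        (((by fun_prop : Continuous fun p : ℝ × ℝ =>
          G ((p.1, b), p.2)).continuousOn.integrableOn_compact hK).mono_set hJK)
    have hq' : ∀ b ∈ Ico (0 : ℝ) 1,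
        ∫ p in Ico (0 : ℝ) 1 ×ˢ J, pd₂ G ((p.1, b), p.2) ^ 2 / G ((p.1, b), p.2) =
          ∫ a in Ico 0 1, ∫ θ in J, pd₂ G ((a, b), θ) ^ 2 / G ((a, b), θ) := fun b hb =>
      setIntegral_prod (fun p : ℝ × ℝ => pd₂ G ((p.1, b), p.2) ^ 2 / G ((p.1, b), p.2))
        (Measure.integrableOn_of_bounded hfin2
          (hm2.comp (by fun_prop : Measurable fun p : ℝ × ℝ =>
            ((p.1, b), p.2))).aestronglyMeasurable
          (ae_restrict_of_forall_mem hJm fun p hp => hbd2 (b, p) ⟨hb, hp⟩))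
    rw [setIntegral_congr_fun measurableSet_Ico hq', ← integral_phaseCell_iterated hi2] at this
    simp_rw [hσ'] at this
    rw [← hM, div_one, one_pow, one_mul] at this
    linarith
  have hF : fisherInfo g = (∫ ξ in phaseCell, pd₁ G ξ ^ 2 / G ξ) +
      (∫ ξ in phaseCell, pd₂ G ξ ^ 2 / G ξ) + ∫ ξ in phaseCell, pd₃ G ξ ^ 2 / G ξ := by
    rw [fisherInfo, phaseIntegral]
    simp_rw [fisherDensity_eq_pd hGd]
    have h12 : IntegrableOn (fun ξ => pd₁ G ξ ^ 2 / G ξ + pd₂ G ξ ^ 2 / G ξ) phaseCell :=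
      hi1.add hi2
    exact (integral_add h12 hi3).trans (congrArg (· + _) (integral_add hi1 hi2))
  have hlog : phaseIntegral g * Real.log (phaseIntegral g / (2 * Real.pi)) =
      phaseIntegral g * Real.log (phaseIntegral g) -
        phaseIntegral g * Real.log (2 * Real.pi) := by
    rcases eq_or_ne (phaseIntegral g) 0 with h | h
    · simp [h]
    · rw [Real.log_div h Real.two_pi_pos.ne']; ring
  have hn : ∀ p : (ℝ × ℝ) × ℝ → ℝ, 0 ≤ ∫ ξ in phaseCell, p ξ ^ 2 / G ξ := fun p =>
    integral_nonneg fun ξ => div_nonneg (sq_nonneg _) (hG0 ξ)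
  -- The cost of each variable is its squared period: `1`, `1` and `(2π)²`. The largest serves as
  -- the common constant.
  have h4 : 1 ≤ 4 * Real.pi ^ 2 := by nlinarith [Real.pi_gt_three]
  have e1 := mul_le_mul_of_nonneg_right h4 (hn (pd₁ G))
  have e2 := mul_le_mul_of_nonneg_right h4 (hn (pd₂ G))
  have e3 : (phaseIntegral fun x θ => g x θ * Real.log (g x θ)) =
    ∫ ξ in phaseCell, G ξ * Real.log (G ξ) := rfl
  rw [e3, hF, hlog]
  have e4 : (2 * Real.pi) ^ 2 = 4 * Real.pi ^ 2 := by ring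
  rw [e4] at hB3
  linarith

/-! ### Regularity of the interaction term -/

theorem contDiff_spaceDensity {g : ℝ × ℝ → ℝ → ℝ}
    (hg : ContDiff ℝ 2 fun ξ : (ℝ × ℝ) × ℝ => g ξ.1 ξ.2) : ContDiff ℝ 2 (spaceDensity g) := by
  have h := contDiff_setIntegral_smul (μ := volume) (s := Ioc 0 (2 * Real.pi)) measurableSet_Ioc
    isCompact_Icc Ioc_subset_Icc_self (w := fun _ => (1 : ℝ))
    (integrableOn_const (by rw [Real.volume_Ioc]; exact ENNReal.ofReal_ne_top)) 2 g hg
  have h1 : spaceDensity g = fun x => ∫ θ in Ioc 0 (2 * Real.pi), (1 : ℝ) • g x θ := by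
    funext x
    rw [spaceDensity, intervalIntegral.integral_of_le Real.two_pi_pos.le]
    simp
  rw [h1]
  exact h

/-- All derivatives fall on `ρ`, so a merely integrable potential yields a `C²` interaction term. -/
theorem contDiff_torusConv {u ρ : ℝ × ℝ → ℝ} (hu : IntegrableOn u spaceCell)
    (hρ : ContDiff ℝ 2 ρ) : ContDiff ℝ 2 (torusConv u ρ) :=
  contDiff_setIntegral_smul measurableSet_spaceCell isCompact_closedSpaceCell spaceCell_subset hu 2
    (fun x y => ρ (x - y)) (hρ.comp (contDiff_fst.sub contDiff_snd))

theorem spacePeriodic_interaction {u : ℝ × ℝ → ℝ} {g : ℝ × ℝ → ℝ → ℝ} (hg : PhasePeriodic g) :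
    SpacePeriodic (interaction u g) := by
  have hρ : SpacePeriodic (spaceDensity g) := fun x => by
    simp only [spaceDensity, fun θ => (hg.1 θ x).1, fun θ => (hg.1 θ x).2, and_self]
  intro x
  simp only [interaction, torusConv, add_sub_right_comm, fun y => (hρ y).1, fun y => (hρ y).2,
    and_self]

/-! ### Evolution of entropies -/

theorem fderiv_periodic {E : Type*} [NormedAddCommGroup E] [NormedSpace ℝ E] {G : E → ℝ} {w : E}
    (h : ∀ ξ, G (ξ + w) = G ξ) (ξ : E) : fderiv ℝ G (ξ + w) = fderiv ℝ G ξ := by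
  rw [← fderiv_comp_add_right]
  simp_rw [h]

theorem spaceDiv_eq {F : ℝ × ℝ → ℝ × ℝ} {x : ℝ × ℝ} {d₁ d₂ : ℝ}
    (h₁ : HasDerivAt (fun s => (F (s, x.2)).1) d₁ x.1)
    (h₂ : HasDerivAt (fun s => (F (x.1, s)).2) d₂ x.2) : spaceDiv F x = d₁ + d₂ := by
  rw [spaceDiv, h₁.deriv, h₂.deriv]

/-- The right-hand side of the model, written with coordinate derivatives on the phase space. -/
noncomputable def modelOperator (Pe : ℝ) (G V : (ℝ × ℝ) × ℝ → ℝ) (ξ : (ℝ × ℝ) × ℝ) : ℝ :=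
  pd₁ (pd₁ G) ξ + pd₂ (pd₂ G) ξ + pd₃ (pd₃ G) ξ + (pd₁ G ξ * pd₁ V ξ + G ξ * pd₁ (pd₁ V) ξ) +
    (pd₂ G ξ * pd₂ V ξ + G ξ * pd₂ (pd₂ V) ξ) -
    Pe * (pd₁ G ξ * Real.cos ξ.2 + pd₂ G ξ * Real.sin ξ.2)

theorem eq_modelOperator {g : ℝ × ℝ → ℝ → ℝ} {U : ℝ × ℝ → ℝ} {Pe d θ : ℝ} {x : ℝ × ℝ}
    (hg : ContDiff ℝ 2 fun ξ : (ℝ × ℝ) × ℝ => g ξ.1 ξ.2) (hU : ContDiff ℝ 2 U)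
    (h : d + Pe * spaceDiv (fun z => g z θ • direction θ) x =
      spaceLaplacian (fun z => g z θ) x + deriv (deriv (fun a => g x a)) θ +
        spaceDiv (fun z => g z θ • spaceGrad U z) x) :
    d = modelOperator Pe (fun ξ => g ξ.1 ξ.2) (fun ξ => U ξ.1) (x, θ) := by
  have hV : ContDiff ℝ 2 fun ξ : (ℝ × ℝ) × ℝ => U ξ.1 := hU.comp contDiff_fst
  have hgd := hg.differentiable (by norm_num)
  have hVd := hV.differentiable (by norm_num)
  have h1 := (contDiff_pd₁ (n := 1) hg).differentiable (by norm_num)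
  have h2 := (contDiff_pd₂ (n := 1) hg).differentiable (by norm_num)
  have h3 := (contDiff_pd₃ (n := 1) hg).differentiable (by norm_num)
  have hV1 := (contDiff_pd₁ (n := 1) hV).differentiable (by norm_num)
  have hV2 := (contDiff_pd₂ (n := 1) hV).differentiable (by norm_num)
  have e1 : spaceDiv (fun z => g z θ • direction θ) x =
      pd₁ (fun ξ => g ξ.1 ξ.2) (x, θ) * Real.cos θ + pd₂ (fun ξ => g ξ.1 ξ.2) (x, θ) * Real.sin θ :=
    spaceDiv_eq ((hasDerivAt_pd₁ hgd x.1 x.2 θ).mul_const _)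
      ((hasDerivAt_pd₂ hgd x.1 x.2 θ).mul_const _)
  have e2 : spaceLaplacian (fun z => g z θ) x =
      pd₁ (pd₁ fun ξ => g ξ.1 ξ.2) (x, θ) + pd₂ (pd₂ fun ξ => g ξ.1 ξ.2) (x, θ) := by
    rw [spaceLaplacian, funext fun x => spaceGrad_eq_pd hgd x θ]
    exact spaceDiv_eq (hasDerivAt_pd₁ h1 x.1 x.2 θ) (hasDerivAt_pd₂ h2 x.1 x.2 θ)
  have e3 : deriv (deriv (fun a => g x a)) θ = pd₃ (pd₃ fun ξ => g ξ.1 ξ.2) (x, θ) := by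
    rw [funext fun θ => deriv_eq_pd₃ hgd x θ]
    exact (hasDerivAt_pd₃ h3 x θ).deriv
  have e4 : spaceDiv (fun z => g z θ • spaceGrad U z) x =
      (pd₁ (fun ξ => g ξ.1 ξ.2) (x, θ) * pd₁ (fun ξ => U ξ.1) (x, θ) +
        g x θ * pd₁ (pd₁ fun ξ => U ξ.1) (x, θ)) +
      (pd₂ (fun ξ => g ξ.1 ξ.2) (x, θ) * pd₂ (fun ξ => U ξ.1) (x, θ) +
        g x θ * pd₂ (pd₂ fun ξ => U ξ.1) (x, θ)) := by
    rw [funext fun z => congrArg (g z θ • ·) (spaceGrad_eq_pd (g := fun z _ => U z) hVd z θ)]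
    exact spaceDiv_eq ((hasDerivAt_pd₁ hgd x.1 x.2 θ).mul (hasDerivAt_pd₁ hV1 x.1 x.2 θ))
      ((hasDerivAt_pd₂ hgd x.1 x.2 θ).mul (hasDerivAt_pd₂ hV2 x.1 x.2 θ))
  rw [e1, e2, e3, e4] at h
  rw [modelOperator]
  linarith

theorem continuous_modelOperator {G V : (ℝ × ℝ) × ℝ → ℝ} (hG : ContDiff ℝ 2 G)
    (hV : ContDiff ℝ 2 V) (Pe : ℝ) : Continuous (modelOperator Pe G V) := by
  have h1 := contDiff_pd₁ (n := 1) hG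
  have h2 := contDiff_pd₂ (n := 1) hG
  have h3 := contDiff_pd₃ (n := 1) hG
  have v1 := contDiff_pd₁ (n := 1) hV
  have v2 := contDiff_pd₂ (n := 1) hV
  have h11 := (contDiff_pd₁ (n := 0) h1).continuous
  have h22 := (contDiff_pd₂ (n := 0) h2).continuous
  have h33 := (contDiff_pd₃ (n := 0) h3).continuous
  have v11 := (contDiff_pd₁ (n := 0) v1).continuous
  have v22 := (contDiff_pd₂ (n := 0) v2).continuous
  have := h1.continuous
  have := h2.continuous
  have := v1.continuous
  have := v2.continuous
  have := hG.continuous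
  unfold modelOperator
  fun_prop

/-- The evolution of the entropy `∫ Λ(G)` under the model, by integration by parts. -/
theorem integral_modelOperator_mul {G V : (ℝ × ℝ) × ℝ → ℝ} (hG : ContDiff ℝ 2 G)
    (hV : ContDiff ℝ 2 V) (hG1 : ∀ ξ, G (ξ + ((1, 0), 0)) = G ξ)
    (hG2 : ∀ ξ, G (ξ + ((0, 1), 0)) = G ξ) (hG3 : ∀ ξ, G (ξ + ((0, 0), 2 * Real.pi)) = G ξ)
    (hV1 : ∀ ξ, V (ξ + ((1, 0), 0)) = V ξ) (hV2 : ∀ ξ, V (ξ + ((0, 1), 0)) = V ξ) (Pe : ℝ)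
    {Λ L L' : ℝ → ℝ} (hΛ : ∀ ξ, HasDerivAt Λ (L (G ξ)) (G ξ))
    (hL : ∀ ξ, HasDerivAt L (L' (G ξ)) (G ξ)) (hL' : Continuous fun ξ => L' (G ξ)) :
    ∫ ξ in phaseCell, modelOperator Pe G V ξ * L (G ξ) =
      -∫ ξ in phaseCell, L' (G ξ) * (pd₁ G ξ ^ 2 + pd₂ G ξ ^ 2 + pd₃ G ξ ^ 2 +
        G ξ * (pd₁ G ξ * pd₁ V ξ + pd₂ G ξ * pd₂ V ξ)) := by
  have h1 := contDiff_pd₁ (n := 1) hG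
  have h2 := contDiff_pd₂ (n := 1) hG
  have h3 := contDiff_pd₃ (n := 1) hG
  have v1 := contDiff_pd₁ (n := 1) hV
  have v2 := contDiff_pd₂ (n := 1) hV
  have h11 := (contDiff_pd₁ (n := 0) h1).continuous
  have h22 := (contDiff_pd₂ (n := 0) h2).continuous
  have h33 := (contDiff_pd₃ (n := 0) h3).continuous
  have v11 := (contDiff_pd₁ (n := 0) v1).continuous
  have v22 := (contDiff_pd₂ (n := 0) v2).continuous
  have c1 := h1.continuous
  have c2 := h2.continuous
  have c3 := h3.continuous
  have cv1 := v1.continuous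
  have cv2 := v2.continuous
  have cG := hG.continuous
  have cL : Continuous fun ξ => L (G ξ) := continuous_iff_continuousAt.2 fun ξ =>
    ContinuousAt.comp (hL ξ).continuousAt cG.continuousAt
  have dG := hG.differentiable (by norm_num)
  have d1 := h1.differentiable (by norm_num)
  have d2 := h2.differentiable (by norm_num)
  have d3 := h3.differentiable (by norm_num)
  have dv1 := v1.differentiable (by norm_num)
  have dv2 := v2.differentiable (by norm_num)
  have p0 : ∀ b θ : ℝ, (((1 : ℝ), b), θ) = ((0, b), θ) + ((1, 0), 0) := fun b θ => by simp
  have q0 : ∀ a θ : ℝ, ((a, (1 : ℝ)), θ) = ((a, 0), θ) + ((0, 1), 0) := fun a θ => by simp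
  have r0 : ∀ x : ℝ × ℝ, (x, 2 * Real.pi) = (x, 0) + ((0, 0), 2 * Real.pi) := fun x => by
    ext <;> simp
  obtain ⟨ℓ, hℓ⟩ : ∃ ℓ : (ℝ × ℝ) × ℝ → ℝ, ∀ ξ, L (G ξ) = ℓ ξ := ⟨_, fun _ => rfl⟩
  obtain ⟨ℓ', hℓ'⟩ : ∃ ℓ' : (ℝ × ℝ) × ℝ → ℝ, ∀ ξ, L' (G ξ) = ℓ' ξ := ⟨_, fun _ => rfl⟩
  simp only [hℓ, hℓ'] at hΛ hL hL' cL ⊢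
  -- `R₁`, `R₂`, `R₃` are the derivatives of flux times `L (G)`, with `Pe cos θ Λ(G)` and `Pe sin θ
  -- Λ(G)` subtracted in the space directions. Thus transport is an exact derivative, and the sum of
  -- the three is the integrand of the difference of the two sides.
  set R₁ : (ℝ × ℝ) × ℝ → ℝ := fun ξ =>
    (pd₁ (pd₁ G) ξ + (pd₁ G ξ * pd₁ V ξ + G ξ * pd₁ (pd₁ V) ξ)) * ℓ ξ +
      (pd₁ G ξ + G ξ * pd₁ V ξ) * (ℓ' ξ * pd₁ G ξ) -
      Pe * Real.cos ξ.2 * (ℓ ξ * pd₁ G ξ) with hR₁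
  set R₂ : (ℝ × ℝ) × ℝ → ℝ := fun ξ =>
    (pd₂ (pd₂ G) ξ + (pd₂ G ξ * pd₂ V ξ + G ξ * pd₂ (pd₂ V) ξ)) * ℓ ξ +
      (pd₂ G ξ + G ξ * pd₂ V ξ) * (ℓ' ξ * pd₂ G ξ) -
      Pe * Real.sin ξ.2 * (ℓ ξ * pd₂ G ξ) with hR₂
  set R₃ : (ℝ × ℝ) × ℝ → ℝ := fun ξ =>
    pd₃ (pd₃ G) ξ * ℓ ξ + pd₃ G ξ * (ℓ' ξ * pd₃ G ξ) with hR₃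
  have cR₁ : Continuous R₁ := by rw [hR₁]; fun_prop
  have cR₂ : Continuous R₂ := by rw [hR₂]; fun_prop
  have cR₃ : Continuous R₃ := by rw [hR₃]; fun_prop
  have i₁ : ∫ ξ in phaseCell, R₁ ξ = 0 := by
    refine integral_phaseCell_deriv_fst_eq_zero (P := fun ξ =>
      (pd₁ G ξ + G ξ * pd₁ V ξ) * L (G ξ) - Pe * Real.cos ξ.2 * Λ (G ξ)) ?_ cR₁ ?_
    · intro a b θ
      have hGa := hasDerivAt_pd₁ dG a b θ
      refine ((((hasDerivAt_pd₁ d1 a b θ).add (hGa.mul (hasDerivAt_pd₁ dv1 a b θ))).mul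
        ((hL ((a, b), θ)).comp a hGa)).sub (((hΛ ((a, b), θ)).comp a hGa).const_mul
          (Pe * Real.cos θ))).congr_deriv ?_
      simp [hℓ, hR₁]
    · intro b θ
      simp only [p0 b θ, hG1, pd₁, fderiv_periodic hG1, fderiv_periodic hV1]
  have i₂ : ∫ ξ in phaseCell, R₂ ξ = 0 := by
    refine integral_phaseCell_deriv_snd_eq_zero (P := fun ξ =>
      (pd₂ G ξ + G ξ * pd₂ V ξ) * L (G ξ) - Pe * Real.sin ξ.2 * Λ (G ξ)) ?_ cR₂ ?_
    · intro a b θ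
      have hGa := hasDerivAt_pd₂ dG a b θ
      refine ((((hasDerivAt_pd₂ d2 a b θ).add (hGa.mul (hasDerivAt_pd₂ dv2 a b θ))).mul
        ((hL ((a, b), θ)).comp b hGa)).sub (((hΛ ((a, b), θ)).comp b hGa).const_mul
          (Pe * Real.sin θ))).congr_deriv ?_
      simp [hℓ, hR₂]
    · intro a θ
      simp only [q0 a θ, hG2, pd₂, fderiv_periodic hG2, fderiv_periodic hV2]
  have i₃ : ∫ ξ in phaseCell, R₃ ξ = 0 := by
    refine integral_phaseCell_deriv_angle_eq_zero (P := fun ξ => pd₃ G ξ * L (G ξ)) ?_ cR₃ ?_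
    · intro x θ
      exact ((hasDerivAt_pd₃ d3 x θ).mul
        ((hL (x, θ)).comp θ (hasDerivAt_pd₃ dG x θ))).congr_deriv (by simp [hℓ, hR₃])
    · intro x
      simp only [r0 x, hG3, pd₃, fderiv_periodic hG3]
  have hcont : Continuous fun ξ => ℓ' ξ * (pd₁ G ξ ^ 2 + pd₂ G ξ ^ 2 + pd₃ G ξ ^ 2 +
        G ξ * (pd₁ G ξ * pd₁ V ξ + pd₂ G ξ * pd₂ V ξ)) := by fun_prop
  have hcont' : Continuous fun ξ => modelOperator Pe G V ξ * ℓ ξ :=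
    (continuous_modelOperator hG hV Pe).mul cL
  rw [eq_neg_iff_add_eq_zero, ← integral_add (integrableOn_phaseCell_of_continuous hcont')
    (integrableOn_phaseCell_of_continuous hcont)]
  have hsum : ∫ ξ in phaseCell, (R₁ ξ + R₂ ξ + R₃ ξ) = 0 := by
    rw [integral_add (integrableOn_phaseCell_of_continuous (by fun_prop))
      (integrableOn_phaseCell_of_continuous cR₃),
      integral_add (integrableOn_phaseCell_of_continuous cR₁)
      (integrableOn_phaseCell_of_continuous cR₂), i₁, i₂, i₃]
    simp
  rw [← hsum]
  refine integral_congr_ae (Eventually.of_forall fun ξ => ?_)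
  simp only [hR₁, hR₂, hR₃, modelOperator]
  ring

/-! ### The entropy production -/

/-- `|d|` is at most a multiple of `√y`, and `√y log y` is bounded on `[0, B]`. The dominating
constant is used with `y = z` for the time derivative of the entropy, and with `y = z + ε` for the
regularised logarithm. -/
theorem exists_abs_mul_log_add_one_le (B C : ℝ) :
    ∃ B', ∀ d y z : ℝ, d ^ 2 ≤ C * z → 0 ≤ z → z ≤ y → y ≤ B →
      |d * (Real.log y + 1)| ≤ B' := by
  have hc : Continuous fun y : ℝ => 2 * |√y * Real.log √y| + √y :=
    ((Real.continuous_mul_log.comp Real.continuous_sqrt).abs.const_mul 2).add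
      Real.continuous_sqrt
  obtain ⟨M, hM⟩ := (isCompact_Icc (a := (0 : ℝ)) (b := B)).exists_bound_of_continuousOn
    hc.continuousOn
  refine ⟨√|C| * M, fun d y z hd hz hzy hyB => ?_⟩
  have hy : 0 ≤ y := hz.trans hzy
  have h1 : |d| ≤ √|C| * √y := by
    rw [← Real.sqrt_mul (abs_nonneg C)]
    refine Real.abs_le_sqrt (hd.trans ?_)
    exact (mul_le_mul_of_nonneg_right (le_abs_self C) hz).trans
      (mul_le_mul_of_nonneg_left hzy (abs_nonneg C))
  have h2 : |Real.log y + 1| ≤ |Real.log y| + 1 := (abs_add_le _ _).trans (by simp)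
  have h3 : √y * (|Real.log y| + 1) = 2 * |√y * Real.log √y| + √y := by
    rw [Real.log_sqrt hy, abs_mul, abs_of_nonneg (Real.sqrt_nonneg y), abs_div, abs_two]
    ring
  have h4 := (le_abs_self _).trans (hM y ⟨hy, hyB⟩)
  calc |d * (Real.log y + 1)| = |d| * |Real.log y + 1| := abs_mul _ _
    _ ≤ √|C| * √y * (|Real.log y| + 1) := mul_le_mul h1 h2 (abs_nonneg _) (by positivity)
    _ = √|C| * (2 * |√y * Real.log √y| + √y) := by rw [mul_assoc, h3]
    _ ≤ √|C| * M := mul_le_mul_of_nonneg_left h4 (Real.sqrt_nonneg _)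

theorem interactionDissipation_eq_pd {u : ℝ × ℝ → ℝ} {g : ℝ × ℝ → ℝ → ℝ}
    (hg : Differentiable ℝ fun ξ : (ℝ × ℝ) × ℝ => g ξ.1 ξ.2)
    (hU : Differentiable ℝ fun ξ : (ℝ × ℝ) × ℝ => interaction u g ξ.1) :
    interactionDissipation u g = ∫ ξ in phaseCell,
      (pd₁ (fun ξ => g ξ.1 ξ.2) ξ * pd₁ (fun ξ => interaction u g ξ.1) ξ +
        pd₂ (fun ξ => g ξ.1 ξ.2) ξ * pd₂ (fun ξ => interaction u g ξ.1) ξ) := by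
  refine integral_congr_ae (Eventually.of_forall fun ξ => ?_)
  simp only [spaceGrad_eq_pd hg ξ.1 ξ.2]
  rw [spaceGrad_eq_pd (g := fun z _ => interaction u g z) hU ξ.1 ξ.2]
  rfl

/-- The entropy production of the model, for a nonnegative density that may have zeros. -/
theorem integral_modelOperator_mul_log {u : ℝ × ℝ → ℝ} {g : ℝ × ℝ → ℝ → ℝ}
    (hu : IntegrableOn u spaceCell) (hper : PhasePeriodic g)
    (hg : ContDiff ℝ 2 fun ξ : (ℝ × ℝ) × ℝ => g ξ.1 ξ.2) (h0 : ∀ x θ, 0 ≤ g x θ) (Pe : ℝ)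
    {D : (ℝ × ℝ) × ℝ → ℝ} (hD : ∀ ξ, D ξ =
      modelOperator Pe (fun ξ => g ξ.1 ξ.2) (fun ξ => interaction u g ξ.1) ξ)
    {C : ℝ} (hC : ∀ ξ ∈ closedPhaseCell, D ξ ^ 2 ≤ C * g ξ.1 ξ.2) :
    ∫ ξ in phaseCell, D ξ * (Real.log (g ξ.1 ξ.2) + 1) =
        -(fisherInfo g + interactionDissipation u g) ∧ ∫ ξ in phaseCell, D ξ = 0 := by
  set G : (ℝ × ℝ) × ℝ → ℝ := fun ξ => g ξ.1 ξ.2 with hG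
  set V : (ℝ × ℝ) × ℝ → ℝ := fun ξ => interaction u g ξ.1 with hV
  have hU : ContDiff ℝ 2 (interaction u g) := contDiff_torusConv hu (contDiff_spaceDensity hg)
  have hVc : ContDiff ℝ 2 V := hU.comp contDiff_fst
  have hG0 : ∀ ξ, 0 ≤ G ξ := fun ξ => h0 ξ.1 ξ.2
  have hUper : SpacePeriodic (interaction u g) := spacePeriodic_interaction hper
  obtain rfl : D = modelOperator Pe G V := funext hD
  have cG : Continuous G := hg.continuous
  have dG : Differentiable ℝ G := hg.differentiable (by norm_num)
  have dV : Differentiable ℝ V := hVc.differentiable (by norm_num)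
  have c1 : Continuous (pd₁ G) := (contDiff_pd₁ (n := 1) hg).continuous
  have c2 : Continuous (pd₂ G) := (contDiff_pd₂ (n := 1) hg).continuous
  have c3 : Continuous (pd₃ G) := (contDiff_pd₃ (n := 1) hg).continuous
  have v1 : Continuous (pd₁ V) := (contDiff_pd₁ (n := 1) hVc).continuous
  have v2 : Continuous (pd₂ V) := (contDiff_pd₂ (n := 1) hVc).continuous
  have cD : Continuous (modelOperator Pe G V) := continuous_modelOperator hg hVc Pe
  have key := @integral_modelOperator_mul G V hg hVc (fun ξ => by simpa [hG] using (hper.1 ξ.2 ξ.1).1)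
      (fun ξ => by simpa [hG] using (hper.1 ξ.2 ξ.1).2)
      (fun ξ => by simpa only [hG, Prod.fst_add, Prod.snd_add, Prod.mk_zero_zero, add_zero]
        using hper.2 ξ.1 ξ.2) (fun ξ => (hUper ξ.1).1) (fun ξ => (hUper ξ.1).2) Pe
  refine ⟨?_, ?_⟩
  swap
  -- Testing with the constant `1` gives conservation of mass.
  · simpa using key (Λ := fun y => y) (L := fun _ => 1) (L' := fun _ => 0)
      (fun ξ => hasDerivAt_id _) (fun ξ => hasDerivAt_const _ _) continuous_const
  obtain ⟨A, hA, hpd⟩ := exists_sq_pd_le hg hG0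
  set S : (ℝ × ℝ) × ℝ → ℝ := fun ξ => pd₁ G ξ ^ 2 + pd₂ G ξ ^ 2 + pd₃ G ξ ^ 2 with hS
  set T : (ℝ × ℝ) × ℝ → ℝ := fun ξ => pd₁ G ξ * pd₁ V ξ + pd₂ G ξ * pd₂ V ξ with hT
  have cS : Continuous S := by rw [hS]; fun_prop
  have cT : Continuous T := by rw [hT]; fun_prop
  have hS0 : ∀ ξ, 0 ≤ S ξ := fun ξ => by rw [hS]; positivity
  have hSA : ∀ ξ ∈ closedPhaseCell, S ξ ≤ 3 * A * G ξ := fun ξ hξ => by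
    obtain ⟨h1, h2, h3⟩ := hpd ξ hξ
    simp only [hS]; linarith
  have hzero : ∀ ξ ∈ closedPhaseCell, G ξ = 0 → S ξ = 0 ∧ T ξ = 0 := by
    intro ξ hξ h
    have h1 := hpd ξ hξ
    simp only [h, mul_zero, sq_nonpos_iff] at h1
    simp [hS, hT, h1]
  obtain ⟨B, hB⟩ := isCompact_closedPhaseCell.exists_bound_of_continuousOn cG.continuousOn
  obtain ⟨BT, hBT⟩ := isCompact_closedPhaseCell.exists_bound_of_continuousOn cT.continuousOn
  obtain ⟨B', hB'⟩ := exists_abs_mul_log_add_one_le (B + 1) C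
  have hfin : ∀ r : ℝ, IntegrableOn (fun _ : (ℝ × ℝ) × ℝ => r) phaseCell := fun r =>
    integrableOn_phaseCell_of_continuous continuous_const
  -- The shift by `ε` makes the logarithm smooth on the range of `G`. The left integrand is
  -- dominated through `D² ≤ C G`, the right one through `S ≤ 3 A G`; where `G = 0`, both integrands
  -- vanish for every `ε`.
  have hreg : ∀ ε : ℝ, 0 < ε →
      ∫ ξ in phaseCell, modelOperator Pe G V ξ * (Real.log (G ξ + ε) + 1) =
        -∫ ξ in phaseCell, (G ξ + ε)⁻¹ * (S ξ + G ξ * T ξ) := by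
    intro ε hε
    have hne : ∀ ξ, G ξ + ε ≠ 0 := fun ξ => by linarith [hG0 ξ]
    refine key (Λ := fun y => (y + ε) * Real.log (y + ε)) (L := fun y => Real.log (y + ε) + 1)
      (L' := fun y => (y + ε)⁻¹) (fun ξ => ?_) (fun ξ => ?_)
      ((cG.add continuous_const).inv₀ hne)
    · exact (Real.hasDerivAt_mul_log (hne ξ)).comp_add_const (G ξ) ε
    · exact ((Real.hasDerivAt_log (hne ξ)).comp_add_const (G ξ) ε).add_const 1
  have hpos : ∀ᶠ ε : ℝ in 𝓝[>] 0, 0 < ε ∧ ε ≤ 1 :=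
    Ioc_mem_nhdsGT zero_lt_one
  have hid : Tendsto (fun ε : ℝ => ε) (𝓝[>] 0) (𝓝 0) := nhdsWithin_le_nhds
  have hlim1 : Tendsto
      (fun ε : ℝ => ∫ ξ in phaseCell, modelOperator Pe G V ξ * (Real.log (G ξ + ε) + 1))
      (𝓝[>] 0) (𝓝 (∫ ξ in phaseCell, modelOperator Pe G V ξ * (Real.log (G ξ) + 1))) := by
    refine tendsto_integral_filter_of_dominated_convergence (fun _ => B') ?_ ?_ (hfin _) ?_
    · refine Eventually.of_forall fun ε => Measurable.aestronglyMeasurable ?_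
      exact cD.measurable.mul
        ((Real.measurable_log.comp (cG.measurable.add_const ε)).add_const 1)
    · filter_upwards [hpos] with ε hε
      refine ae_restrict_of_forall_mem measurableSet_phaseCell fun ξ hξ => ?_
      have hξ := phaseCell_subset hξ
      exact hB' _ _ _ (hC ξ hξ) (hG0 ξ) (by linarith)
        (add_le_add ((le_abs_self _).trans (hB ξ hξ)) hε.2)
    · refine ae_restrict_of_forall_mem measurableSet_phaseCell fun ξ hξ => ?_
      rcases eq_or_ne (G ξ) 0 with h | h
      · have h1 := hC ξ (phaseCell_subset hξ)
        change _ ≤ C * G ξ at h1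
        rw [h, mul_zero, sq_nonpos_iff] at h1
        simp [h1]
      · have h1 : Tendsto (fun ε : ℝ => G ξ + ε) (𝓝[>] 0) (𝓝 (G ξ)) := by
          simpa using hid.const_add (G ξ)
        exact ((h1.log h).add_const 1).const_mul _
  have hlim2 : Tendsto (fun ε : ℝ => ∫ ξ in phaseCell, (G ξ + ε)⁻¹ * (S ξ + G ξ * T ξ))
      (𝓝[>] 0) (𝓝 (∫ ξ in phaseCell, (S ξ / G ξ + T ξ))) := by
    refine tendsto_integral_filter_of_dominated_convergence (fun _ => 3 * A + BT) ?_ ?_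
      (hfin _) ?_
    · refine Eventually.of_forall fun ε => Measurable.aestronglyMeasurable ?_
      exact (cG.measurable.add_const ε).inv.mul (cS.add (cG.mul cT)).measurable
    · filter_upwards [hpos] with ε hε
      refine ae_restrict_of_forall_mem measurableSet_phaseCell fun ξ hξ => ?_
      have hξ := phaseCell_subset hξ
      have h1 : 0 < G ξ + ε := by linarith [hG0 ξ, hε.1]
      have h2 : |T ξ| ≤ BT := hBT ξ hξ
      rw [norm_mul, norm_inv, Real.norm_of_nonneg h1.le, inv_mul_le_iff₀ h1]
      refine (norm_add_le _ _).trans ?_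
      rw [norm_mul, Real.norm_of_nonneg (hS0 ξ), Real.norm_of_nonneg (hG0 ξ), Real.norm_eq_abs]
      have h3 := hSA ξ hξ
      have h4 : G ξ * |T ξ| ≤ G ξ * BT := mul_le_mul_of_nonneg_left h2 (hG0 ξ)
      have h5 : 0 ≤ ε * (3 * A + BT) :=
        mul_nonneg hε.1.le (by linarith [abs_nonneg (T ξ)])
      linarith
    · refine ae_restrict_of_forall_mem measurableSet_phaseCell fun ξ hξ => ?_
      rcases eq_or_ne (G ξ) 0 with h | h
      · obtain ⟨h1, h2⟩ := hzero ξ (phaseCell_subset hξ) h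
        simp [h1, h2]
      · have h1 : Tendsto (fun ε : ℝ => G ξ + ε) (𝓝[>] 0) (𝓝 (G ξ)) := by
          simpa using hid.const_add (G ξ)
        have h2 := (h1.inv₀ h).mul_const (S ξ + G ξ * T ξ)
        have h3 : (G ξ)⁻¹ * (S ξ + G ξ * T ξ) = S ξ / G ξ + T ξ := by field_simp
        rwa [h3] at h2
  have hlim3 := hlim2.neg.congr' (hpos.mono fun ε hε => (hreg ε hε.1).symm)
  rw [tendsto_nhds_unique hlim1 hlim3, interactionDissipation_eq_pd dG dV]
  have hF : fisherInfo g = ∫ ξ in phaseCell, S ξ / G ξ := by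
    refine integral_congr_ae (Eventually.of_forall fun ξ => ?_)
    simp only [fisherDensity_eq_pd dG]
    simp only [hS, add_div]
    rfl
  have hSi : IntegrableOn (fun ξ => S ξ / G ξ) phaseCell := by
    refine (integrableOn_fisherDensity hg h0).congr (Eventually.of_forall fun ξ => ?_)
    simp only [fisherDensity_eq_pd dG]
    simp only [hS, add_div]
    rfl
  rw [hF, integral_add hSi (integrableOn_phaseCell_of_continuous cT)]

/-! ### The Csiszár–Kullback–Pinsker inequality -/

theorem continuous_mul_log_div {X : Type*} [TopologicalSpace X] {G : X → ℝ} (hG : Continuous G)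
    (r : ℝ) : Continuous fun ξ => G ξ * Real.log (G ξ / r) := by
  rcases eq_or_ne r 0 with rfl | hr
  · simpa using continuous_const
  · have h : (fun ξ => G ξ * Real.log (G ξ / r)) =
        fun ξ => r * ((G ξ / r) * Real.log (G ξ / r)) := by
      funext ξ; field_simp
    rw [h]
    exact continuous_const.mul (Real.continuous_mul_log.comp (hG.div_const r))

/-- Cauchy–Schwarz with `(g - r)² ≤ q p`, where `r` is the homogeneous state, `∫ q` is the relative
entropy and `∫ p = 2 φ`. -/
theorem sq_l1Dist_le {φ : ℝ} {g : ℝ × ℝ → ℝ → ℝ}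
    (hg : Continuous fun ξ : (ℝ × ℝ) × ℝ => g ξ.1 ξ.2) (h0 : ∀ x θ, 0 ≤ g x θ)
    (hφ : phaseIntegral g = φ) : l1Dist φ g ^ 2 ≤ 2 * φ * relEntropy φ g := by
  have hφ0 : 0 ≤ φ := hφ ▸ integral_nonneg fun ξ => h0 ξ.1 ξ.2
  have hgi := integrableOn_phaseCell_of_continuous hg
  rcases hφ0.eq_or_lt with h | h
  · subst h
    have h1 : l1Dist 0 g = phaseIntegral g := by
      simp [l1Dist, homogeneousState, phaseIntegral, abs_of_nonneg (h0 _ _)]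
    rw [h1, hφ]
    simp
  set r := homogeneousState φ with hr
  have hr0 : 0 < r := div_pos h Real.two_pi_pos
  have hrφ : 2 * Real.pi * r = φ := by
    rw [hr, homogeneousState, mul_div_cancel₀ _ Real.two_pi_pos.ne']
  have hlog := integrableOn_phaseCell_of_continuous (continuous_mul_log_div hg r)
  have hconst := integrableOn_phaseCell_of_continuous
    (continuous_const (X := (ℝ × ℝ) × ℝ) (y := r))
  set q : (ℝ × ℝ) × ℝ → ℝ := fun ξ =>
    g ξ.1 ξ.2 * Real.log (g ξ.1 ξ.2 / r) - g ξ.1 ξ.2 + r with hq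
  -- This is `r / 3` times the factor `2 x + 4` of `three_mul_sq_sub_one_le` at `x = g / r`.
  set p : (ℝ × ℝ) × ℝ → ℝ := fun ξ => (2 / 3) * g ξ.1 ξ.2 + (4 / 3) * r with hp
  have hscale : ∀ ξ, q ξ = r * (g ξ.1 ξ.2 / r * Real.log (g ξ.1 ξ.2 / r) - g ξ.1 ξ.2 / r + 1) :=
    fun ξ => by simp only [hq]; field_simp
  have hx0 : ∀ ξ : (ℝ × ℝ) × ℝ, 0 ≤ g ξ.1 ξ.2 / r := fun ξ => div_nonneg (h0 _ _) hr0.le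
  have hq0 : ∀ ξ, 0 ≤ q ξ := by
    intro ξ
    rw [hscale]
    refine mul_nonneg hr0.le ?_
    have h1 := (by positivity : (0 : ℝ) ≤ 3 * (g ξ.1 ξ.2 / r - 1) ^ 2).trans (three_mul_sq_sub_one_le (hx0 ξ))
    exact nonneg_of_mul_nonneg_right h1 (by linarith [hx0 ξ])
  have hle : ∀ ξ : (ℝ × ℝ) × ℝ, (g ξ.1 ξ.2 - r) ^ 2 ≤ q ξ * p ξ := by
    intro ξ
    have h1 : (g ξ.1 ξ.2 - r) ^ 2 = r ^ 2 / 3 * (3 * (g ξ.1 ξ.2 / r - 1) ^ 2) := by field_simp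
    have h2 : q ξ * p ξ = r ^ 2 / 3 * ((2 * (g ξ.1 ξ.2 / r) + 4) *
        (g ξ.1 ξ.2 / r * Real.log (g ξ.1 ξ.2 / r) - g ξ.1 ξ.2 / r + 1)) := by
      rw [hscale]; simp only [hp]; field_simp
    rw [h1, h2]
    exact mul_le_mul_of_nonneg_left (three_mul_sq_sub_one_le (hx0 ξ)) (by positivity)
  have hqi : IntegrableOn q phaseCell := (hlog.sub hgi).add hconst
  have hpi : IntegrableOn p phaseCell := integrableOn_phaseCell_of_continuous (by fun_prop)
  have hq1 : ∫ ξ in phaseCell, q ξ = relEntropy φ g := by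
    have h12 : IntegrableOn (fun ξ : (ℝ × ℝ) × ℝ =>
      g ξ.1 ξ.2 * Real.log (g ξ.1 ξ.2 / r) - g ξ.1 ξ.2) phaseCell := hlog.sub hgi
    simp only [hq]
    rw [integral_add h12 hconst, integral_sub hlog hgi, integral_phaseCell_const, hrφ]
    change relEntropy φ g - phaseIntegral g + φ = _
    rw [hφ]; ring
  have hp1 : ∫ ξ in phaseCell, p ξ = 2 * φ := by
    simp only [hp]
    rw [integral_add (hgi.const_mul _) (hconst.const_mul _), integral_const_mul,
      integral_const_mul, integral_phaseCell_const, hrφ]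
    change 2 / 3 * phaseIntegral g + _ = _
    rw [hφ]; ring
  have := sq_integral_abs_le hqi hpi (hgi.sub hconst) (Eventually.of_forall hq0)
    (Eventually.of_forall fun ξ => by
      have := h0 ξ.1 ξ.2
      simp only [hp]; positivity) (Eventually.of_forall hle)
  rw [hq1, hp1, mul_comm] at this
  exact this

/-! ### Evolution in time -/

/-- Differentiability of `g'` at `t` gives `g' = O(s - t)`, and the mean value inequality integrates
this once more. -/
theorem exists_eventually_le_mul_sq {g g' : ℝ → ℝ} {t d : ℝ}
    (hg : ∀ᶠ s in 𝓝 t, HasDerivAt g (g' s) s) (hg' : HasDerivAt g' d t) (h0 : g t = 0)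
    (h1 : g' t = 0) : ∃ C, ∀ᶠ s in 𝓝 t, g s ≤ C * (s - t) ^ 2 := by
  obtain ⟨C, hC⟩ := hg'.isBigO_sub.bound
  refine ⟨C, ?_⟩
  obtain ⟨δ, hδ, hball⟩ := Metric.eventually_nhds_iff_ball.1 (hg.and hC)
  filter_upwards [Metric.ball_mem_nhds t hδ] with s hs
  have hsub : Metric.closedBall t |s - t| ⊆ Metric.ball t δ :=
    Metric.closedBall_subset_ball hs
  have hCs : ∀ r ∈ Metric.closedBall t |s - t|, ‖g' r‖ ≤ |C| * |s - t| := by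
    intro r hr
    have h2 := (hball r (hsub hr)).2
    rw [h1, sub_zero] at h2
    exact h2.trans (mul_le_mul (le_abs_self C) hr (norm_nonneg _) (abs_nonneg C))
  have hts : t ∈ Metric.closedBall t |s - t| := Metric.mem_closedBall_self (abs_nonneg _)
  have hss : s ∈ Metric.closedBall t |s - t| := by
    rw [Metric.mem_closedBall, Real.dist_eq]
  have hC0 : |C| * |s - t| ≤ C * |s - t| ∨ s = t := by
    by_cases hst : s = t
    · exact Or.inr hst
    · left
      have h3 := (norm_nonneg _).trans (hball s hs).2
      have h4 : 0 < ‖s - t‖ := norm_pos_iff.2 (sub_ne_zero.2 hst)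
      rw [abs_of_nonneg (nonneg_of_mul_nonneg_left h3 h4)]
  have h5 := (convex_closedBall t |s - t|).norm_image_sub_le_of_norm_hasDerivWithin_le
    (fun r hr => (hball r (hsub hr)).1.hasDerivWithinAt) hCs hts hss
  rw [h0, sub_zero] at h5
  rcases hC0 with h | h
  · calc g s ≤ ‖g s‖ := le_abs_self _
      _ ≤ |C| * |s - t| * |s - t| := h5
      _ ≤ C * |s - t| * |s - t| := mul_le_mul_of_nonneg_right h (abs_nonneg _)
      _ = C * (s - t) ^ 2 := by rw [mul_assoc, abs_mul_abs_self, sq]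
  · rw [h]; simp [h0]

namespace IsModel1Solution

variable {u : ℝ × ℝ → ℝ} {Pe : ℝ} {f : ℝ → ℝ × ℝ → ℝ → ℝ}

theorem contDiff_slice (hf : IsModel1Solution u Pe f) {t : ℝ} (ht : 0 < t) :
    ContDiff ℝ 2 fun ξ : (ℝ × ℝ) × ℝ => f t ξ.1 ξ.2 :=
  contDiffOn_univ.1 (hf.contDiffOn.comp (s := univ) (f := fun ξ : (ℝ × ℝ) × ℝ => (t, ξ))
    (contDiff_const.prodMk contDiff_id).contDiffOn fun _ _ => ⟨ht, trivial⟩)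

theorem contDiffAt_time (hf : IsModel1Solution u Pe f) {t : ℝ} (ht : 0 < t) (ξ : (ℝ × ℝ) × ℝ) :
    ContDiffAt ℝ 2 (fun s => f s ξ.1 ξ.2) t :=
  (hf.contDiffOn.contDiffAt ((isOpen_Ioi.prod isOpen_univ).mem_nhds
    (show (t, ξ) ∈ Ioi (0 : ℝ) ×ˢ univ from ⟨ht, trivial⟩))).comp t
      (contDiffAt_id.prodMk contDiffAt_const)

theorem hasDerivAt_time (hf : IsModel1Solution u Pe f) {t : ℝ} (ht : 0 < t) (ξ : (ℝ × ℝ) × ℝ) :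
    HasDerivAt (fun s => f s ξ.1 ξ.2) (deriv (fun s => f s ξ.1 ξ.2) t) t :=
  ((hf.contDiffAt_time ht ξ).differentiableAt (by norm_num)).hasDerivAt

theorem deriv_eq_fderiv (hf : IsModel1Solution u Pe f) {t : ℝ} (ht : 0 < t) (ξ : (ℝ × ℝ) × ℝ) :
    deriv (fun s => f s ξ.1 ξ.2) t =
      fderiv ℝ (fun p : ℝ × (ℝ × ℝ) × ℝ => f p.1 p.2.1 p.2.2) (t, ξ) (1, 0) := by
  have h := ((hf.contDiffOn.contDiffAt ((isOpen_Ioi.prod isOpen_univ).mem_nhds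
    (show (t, ξ) ∈ Ioi (0 : ℝ) ×ˢ univ from ⟨ht, trivial⟩))).differentiableAt
      (by norm_num)).hasFDerivAt
  exact (h.comp_hasDerivAt t ((hasDerivAt_id t).prodMk (hasDerivAt_const t ξ))).deriv

/-- The estimate for nonnegative `C²` functions is applied in space-time, in the time direction, on
a compact window away from `t = 0`. -/
theorem exists_sq_deriv_le (hf : IsModel1Solution u Pe f) {t : ℝ} (ht : 0 < t) :
    ∃ C, ∀ s ∈ Icc (t / 2) (2 * t), ∀ ξ ∈ closedPhaseCell,
      deriv (fun s => f s ξ.1 ξ.2) s ^ 2 ≤ C * f s ξ.1 ξ.2 := by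
  have hpos : ∀ s ∈ Icc (t / 2) (2 * t), 0 < s := fun s hs => (half_pos ht).trans_le hs.1
  obtain ⟨C, -, hC⟩ := exists_sq_fderiv_le (isOpen_Ioi.prod isOpen_univ) hf.contDiffOn
    (fun p hp => hf.nonneg p.1 (le_of_lt hp.1) p.2.1 p.2.2)
    ((isCompact_Icc (a := t / 2) (b := 2 * t)).prod isCompact_closedPhaseCell)
    (fun p hp => ⟨hpos p.1 hp.1, trivial⟩) (1, 0)
  refine ⟨C, fun s hs ξ hξ => ?_⟩
  rw [hf.deriv_eq_fderiv (hpos s hs)]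
  exact hC (s, ξ) ⟨hs, hξ⟩

/-- A zero of `f` is a minimum in time, so `∂ₜf` vanishes there and `C²` regularity gives the
quadratic bound that the chain rule needs. -/
theorem hasDerivAt_mul_log (hf : IsModel1Solution u Pe f) {t : ℝ} (ht : 0 < t)
    (ξ : (ℝ × ℝ) × ℝ) :
    HasDerivAt (fun s => f s ξ.1 ξ.2 * Real.log (f s ξ.1 ξ.2))
      (deriv (fun s => f s ξ.1 ξ.2) t * (Real.log (f t ξ.1 ξ.2) + 1)) t := by
  have hnn : ∀ᶠ s in 𝓝 t, 0 ≤ f s ξ.1 ξ.2 := by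
    filter_upwards [lt_mem_nhds ht] with s hs using hf.nonneg s hs.le _ _
  refine hasDerivAt_mul_log_of_nonneg (hf.hasDerivAt_time ht ξ) hnn fun h0 => ?_
  have hmin : IsLocalMin (fun s => f s ξ.1 ξ.2) t := by
    filter_upwards [hnn] with s hs
    rwa [h0]
  have hC : ContDiffOn ℝ 2 (fun s => f s ξ.1 ξ.2) (Ioi 0) := fun s hs =>
    (hf.contDiffAt_time hs ξ).contDiffWithinAt
  have hd : DifferentiableAt ℝ (deriv fun s => f s ξ.1 ξ.2) t :=
    ((hC.deriv_of_isOpen (m := 1) isOpen_Ioi (by norm_num)).contDiffAt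
      (isOpen_Ioi.mem_nhds ht)).differentiableAt (by norm_num)
  refine exists_eventually_le_mul_sq ?_ hd.hasDerivAt h0 hmin.deriv_eq_zero
  filter_upwards [lt_mem_nhds ht] with s hs using hf.hasDerivAt_time hs ξ

theorem deriv_eq_modelOperator (hf : IsModel1Solution u Pe f) (hu : IntegrableOn u spaceCell)
    {t : ℝ} (ht : 0 < t) (ξ : (ℝ × ℝ) × ℝ) :
    deriv (fun s => f s ξ.1 ξ.2) t =
      modelOperator Pe (fun ξ => f t ξ.1 ξ.2) (fun ξ => interaction u (f t) ξ.1) ξ :=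
  eq_modelOperator (hf.contDiff_slice ht)
    (contDiff_torusConv hu (contDiff_spaceDensity (hf.contDiff_slice ht)))
    (hf.equation t ht ξ.1 ξ.2)

theorem continuous_deriv (hf : IsModel1Solution u Pe f) (hu : IntegrableOn u spaceCell)
    {t : ℝ} (ht : 0 < t) :
    Continuous fun ξ : (ℝ × ℝ) × ℝ => deriv (fun s => f s ξ.1 ξ.2) t := by
  rw [funext (hf.deriv_eq_modelOperator hu ht)]
  exact continuous_modelOperator (hf.contDiff_slice ht) ((contDiff_torusConv hu
    (contDiff_spaceDensity (hf.contDiff_slice ht))).comp contDiff_fst) Pe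

theorem continuous_slice (hf : IsModel1Solution u Pe f) {t : ℝ} (ht : 0 ≤ t) :
    Continuous fun ξ : (ℝ × ℝ) × ℝ => f t ξ.1 ξ.2 :=
  hf.continuousOn.comp_continuous (f := fun ξ : (ℝ × ℝ) × ℝ => (t, ξ)) (by fun_prop)
    fun _ => ⟨ht, trivial⟩

theorem continuousOn_integral_comp (hf : IsModel1Solution u Pe f) {Ψ : ℝ → ℝ}
    (hΨ : Continuous Ψ) :
    ContinuousOn (fun t => phaseIntegral fun x θ => Ψ (f t x θ)) (Ici 0) := by
  -- Freezing `f` at its initial value for negative times makes it continuous for all times and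
  -- gives continuity of the integral up to `t = 0`.
  have h : Continuous (Function.uncurry fun (t : ℝ) (ξ : (ℝ × ℝ) × ℝ) =>
      Ψ (f (max t 0) ξ.1 ξ.2)) :=
    hΨ.comp (hf.continuousOn.comp_continuous
      (f := fun p : ℝ × (ℝ × ℝ) × ℝ => (max p.1 0, p.2)) (by fun_prop)
      fun p => ⟨mem_Ici.2 (le_max_right _ _), trivial⟩)
  refine (continuous_setIntegral_of_continuous (μ := volume) measurableSet_phaseCell
    isCompact_closedPhaseCell phaseCell_subset h).continuousOn.congr fun t ht => ?_
  simp only [max_eq_left (mem_Ici.1 ht)]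
  rfl

theorem exists_bound (hf : IsModel1Solution u Pe f) {t : ℝ} (ht : 0 < t) :
    ∃ B, ∀ s ∈ Icc (t / 2) (2 * t), ∀ ξ ∈ closedPhaseCell, f s ξ.1 ξ.2 ≤ B := by
  obtain ⟨B, hB⟩ := ((isCompact_Icc (a := t / 2) (b := 2 * t)).prod
    isCompact_closedPhaseCell).exists_bound_of_continuousOn (hf.continuousOn.mono
      fun p hp => ⟨(half_pos ht).le.trans hp.1.1, trivial⟩)
  exact ⟨B, fun s hs ξ hξ => (le_abs_self _).trans (hB (s, ξ) ⟨hs, hξ⟩)⟩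

theorem Icc_mem_nhds_time {t : ℝ} (ht : 0 < t) : Icc (t / 2) (2 * t) ∈ 𝓝 t :=
  Icc_mem_nhds (by linarith) (by linarith)

/-- Time derivative of the entropy. -/
theorem hasDerivAt_entropy (hf : IsModel1Solution u Pe f) (hu : IntegrableOn u spaceCell)
    {t : ℝ} (ht : 0 < t) :
    HasDerivAt (fun s => phaseIntegral fun x θ => f s x θ * Real.log (f s x θ))
      (-(fisherInfo (f t) + interactionDissipation u (f t))) t := by
  obtain ⟨C, hC⟩ := hf.exists_sq_deriv_le ht
  obtain ⟨B, hB⟩ := hf.exists_bound ht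
  obtain ⟨B', hB'⟩ := exists_abs_mul_log_add_one_le B C
  have hmem := Icc_mem_nhds_time ht
  have hpos : ∀ s ∈ Icc (t / 2) (2 * t), 0 < s := fun s hs => (half_pos ht).trans_le hs.1
  have hcont : ∀ s, 0 ≤ s →
      Continuous fun ξ : (ℝ × ℝ) × ℝ => f s ξ.1 ξ.2 * Real.log (f s ξ.1 ξ.2) :=
    fun s hs => Real.continuous_mul_log.comp (hf.continuous_slice hs)
  have h1 := (hasDerivAt_integral_of_dominated_loc_of_deriv_le
    (μ := volume.restrict phaseCell) (bound := fun _ => B')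
    (F := fun s (ξ : (ℝ × ℝ) × ℝ) => f s ξ.1 ξ.2 * Real.log (f s ξ.1 ξ.2))
    (F' := fun s ξ => deriv (fun s => f s ξ.1 ξ.2) s * (Real.log (f s ξ.1 ξ.2) + 1)) hmem
    (by filter_upwards [hmem] with s hs using (hcont s (hpos s hs).le).aestronglyMeasurable)
    (integrableOn_phaseCell_of_continuous (hcont t ht.le))
    ((hf.continuous_deriv hu ht).measurable.mul ((Real.measurable_log.comp
      (hf.continuous_slice ht.le).measurable).add_const 1)).aestronglyMeasurable
    (ae_restrict_of_forall_mem measurableSet_phaseCell fun ξ hξ s hs =>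
      hB' _ _ _ (hC s hs ξ (phaseCell_subset hξ)) (hf.nonneg s (hpos s hs).le _ _) le_rfl
        (hB s hs ξ (phaseCell_subset hξ)))
    (integrableOn_phaseCell_of_continuous continuous_const)
    (Eventually.of_forall fun ξ s hs => hf.hasDerivAt_mul_log (hpos s hs) ξ)).2
  rwa [(integral_modelOperator_mul_log hu (hf.periodic t ht.le) (hf.contDiff_slice ht)
    (hf.nonneg t ht.le) Pe (hf.deriv_eq_modelOperator hu ht)
    (hC t (mem_of_mem_nhds hmem))).1] at h1

theorem hasDerivAt_mass (hf : IsModel1Solution u Pe f) (hu : IntegrableOn u spaceCell)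
    {t : ℝ} (ht : 0 < t) : HasDerivAt (fun s => phaseIntegral (f s)) 0 t := by
  obtain ⟨C, hC⟩ := hf.exists_sq_deriv_le ht
  obtain ⟨B, hB⟩ := hf.exists_bound ht
  have hmem := Icc_mem_nhds_time ht
  have hpos : ∀ s ∈ Icc (t / 2) (2 * t), 0 < s := fun s hs => (half_pos ht).trans_le hs.1
  have h1 := (hasDerivAt_integral_of_dominated_loc_of_deriv_le
    (μ := volume.restrict phaseCell) (bound := fun _ => √(|C| * B))
    (F := fun s (ξ : (ℝ × ℝ) × ℝ) => f s ξ.1 ξ.2)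
    (F' := fun s ξ => deriv (fun s => f s ξ.1 ξ.2) s) hmem
    (by filter_upwards [hmem] with s hs using
      (hf.continuous_slice (hpos s hs).le).aestronglyMeasurable)
    (integrableOn_phaseCell_of_continuous (hf.continuous_slice ht.le))
    (hf.continuous_deriv hu ht).aestronglyMeasurable
    (ae_restrict_of_forall_mem measurableSet_phaseCell fun ξ hξ s hs =>
      Real.abs_le_sqrt ((hC s hs ξ (phaseCell_subset hξ)).trans
        ((mul_le_mul_of_nonneg_right (le_abs_self C) (hf.nonneg s (hpos s hs).le _ _)).trans
          (mul_le_mul_of_nonneg_left (hB s hs ξ (phaseCell_subset hξ)) (abs_nonneg C)))))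
    (integrableOn_phaseCell_of_continuous continuous_const)
    (Eventually.of_forall fun ξ s hs => hf.hasDerivAt_time (hpos s hs) ξ)).2
  rwa [(integral_modelOperator_mul_log hu (hf.periodic t ht.le) (hf.contDiff_slice ht)
    (hf.nonneg t ht.le) Pe (hf.deriv_eq_modelOperator hu ht)
    (hC t (mem_of_mem_nhds hmem))).2] at h1

/-- Conservation of mass. -/
theorem phaseIntegral_eq (hf : IsModel1Solution u Pe f) (hu : IntegrableOn u spaceCell)
    {t : ℝ} (ht : 0 ≤ t) : phaseIntegral (f t) = phaseIntegral (f 0) := by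
  have hc : ContinuousOn (fun s => phaseIntegral (f s)) (Ici 0) :=
    hf.continuousOn_integral_comp continuous_id
  have hd : ∀ s ∈ interior (Ici (0 : ℝ)), HasDerivAt (fun s => phaseIntegral (f s)) 0 s :=
    fun s hs => hf.hasDerivAt_mass hu (by simpa using hs)
  refine le_antisymm ?_ ?_
  · exact antitoneOn_of_deriv_nonpos (convex_Ici 0) hc
      (fun s hs => (hd s hs).differentiableAt.differentiableWithinAt)
      (fun s hs => (hd s hs).deriv.le) self_mem_Ici ht ht
  · exact monotoneOn_of_deriv_nonneg (convex_Ici 0) hc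
      (fun s hs => (hd s hs).differentiableAt.differentiableWithinAt)
      (fun s hs => (hd s hs).deriv.ge) self_mem_Ici ht ht

end IsModel1Solution

/-- The relative entropy in terms of the entropy and the mass. -/
theorem relEntropy_eq {φ : ℝ} {g : ℝ × ℝ → ℝ → ℝ}
    (hg : Continuous fun ξ : (ℝ × ℝ) × ℝ => g ξ.1 ξ.2) (h0 : ∀ x θ, 0 ≤ g x θ)
    (hφ : phaseIntegral g = φ) :
    relEntropy φ g = (phaseIntegral fun x θ => g x θ * Real.log (g x θ)) -
      φ * Real.log (φ / (2 * Real.pi)) := by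
  have hgi := integrableOn_phaseCell_of_continuous hg
  -- For zero mass the quotient by the homogeneous state is a division by zero; but then `g = 0`
  -- almost everywhere and both sides vanish.
  rcases eq_or_ne φ 0 with h | h
  · subst h
    have h1 : (fun ξ : (ℝ × ℝ) × ℝ => g ξ.1 ξ.2) =ᵐ[volume.restrict phaseCell] 0 :=
      (setIntegral_eq_zero_iff_of_nonneg_ae
        (Eventually.of_forall fun ξ : (ℝ × ℝ) × ℝ => h0 ξ.1 ξ.2) hgi).1 hφ
    rw [zero_mul, sub_zero]
    refine integral_congr_ae ?_
    filter_upwards [h1] with ξ hξ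
    simp only [Pi.zero_apply] at hξ
    simp [hξ]
  · have hr : homogeneousState φ ≠ 0 := div_ne_zero h Real.two_pi_pos.ne'
    have hlog := integrableOn_phaseCell_of_continuous (Real.continuous_mul_log.comp hg)
    rw [← hφ]
    simp only [relEntropy, phaseIntegral]
    rw [← integral_mul_const]
    refine Eq.trans ?_ (integral_sub hlog (hgi.mul_const _))
    refine integral_congr_ae (Eventually.of_forall fun ξ => ?_)
    change g ξ.1 ξ.2 * Real.log (g ξ.1 ξ.2 / homogeneousState (phaseIntegral g)) =
      g ξ.1 ξ.2 * Real.log (g ξ.1 ξ.2) -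
        g ξ.1 ξ.2 * Real.log (homogeneousState (phaseIntegral g))
    rw [hφ]
    rcases eq_or_ne (g ξ.1 ξ.2) 0 with h2 | h2
    · simp [h2]
    · rw [Real.log_div h2 hr]; ring

end ActiveBrownian

/-! ### Exponential decay of the relative entropy and convergence in `L¹`. -/

theorem mainTheorem2 :
    ∃ c : ℝ, 0 < c ∧
      ∀ u : ℝ × ℝ → ℝ, SpacePeriodic u → IntegrableOn u spaceCell → RepulsionCondition u →
      ∀ (Pe φ : ℝ) (f : ℝ → ℝ × ℝ → ℝ → ℝ),
        IsModel1Solution u Pe f → phaseIntegral (f 0) = φ →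
        (∀ t, 0 < t →
          IntegrableOn (fun ξ : (ℝ × ℝ) × ℝ => fisherDensity (f t) ξ.1 ξ.2) phaseCell ∧
          HasDerivAt (fun s => relEntropy φ (f s))
            (-(fisherInfo (f t) + interactionDissipation u (f t))) t ∧
          deriv (fun s => relEntropy φ (f s)) t ≤ -fisherInfo (f t) ∧
          deriv (fun s => relEntropy φ (f s)) t ≤ -(c * relEntropy φ (f t))) ∧
        (∀ t, 0 ≤ t → relEntropy φ (f t) ≤ relEntropy φ (f 0) * Real.exp (-(c * t))) ∧
        (∀ t, 0 ≤ t → l1Dist φ (f t) ^ 2 ≤ 2 * φ * relEntropy φ (f t)) ∧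
        Tendsto (fun t => l1Dist φ (f t)) atTop (𝓝 0) := by
  have hpi := Real.pi_pos
  -- The rate is the reciprocal of the constant in `entropy_phaseCell_le`.
  refine ⟨1 / (4 * Real.pi ^ 2), by positivity, ?_⟩
  set c := 1 / (4 * Real.pi ^ 2) with hc
  have hc0 : 0 < c := by positivity
  intro u _ hu hrep Pe φ f hf hφ
  have hmass : ∀ t, 0 ≤ t → phaseIntegral (f t) = φ := fun t ht => by
    rw [hf.phaseIntegral_eq hu ht, hφ]
  have hrel : ∀ t, 0 ≤ t → relEntropy φ (f t) =
      (phaseIntegral fun x θ => f t x θ * Real.log (f t x θ)) -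
        φ * Real.log (φ / (2 * Real.pi)) := fun t ht =>
    relEntropy_eq (hf.continuous_slice ht) (hf.nonneg t ht) (hmass t ht)
  have hderiv : ∀ t, 0 < t → HasDerivAt (fun s => relEntropy φ (f s))
      (-(fisherInfo (f t) + interactionDissipation u (f t))) t := by
    intro t ht
    refine ((hf.hasDerivAt_entropy hu ht).sub_const
      (φ * Real.log (φ / (2 * Real.pi)))).congr_of_eventuallyEq ?_
    filter_upwards [lt_mem_nhds ht] with s hs using hrel s hs.le
  have hfisher : ∀ t, 0 < t → deriv (fun s => relEntropy φ (f s)) t ≤ -fisherInfo (f t) := by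
    intro t ht
    rw [(hderiv t ht).deriv]
    have := hrep (f t) (hf.periodic t ht.le) (hf.contDiff_slice ht) (hf.nonneg t ht.le)
    linarith
  have hdecay : ∀ t, 0 < t →
      deriv (fun s => relEntropy φ (f s)) t ≤ -(c * relEntropy φ (f t)) := by
    intro t ht
    refine (hfisher t ht).trans (neg_le_neg ?_)
    have h1 := entropy_phaseCell_le (hf.contDiff_slice ht) (hf.nonneg t ht.le)
    rw [hmass t ht.le, ← hrel t ht.le] at h1
    rw [hc, one_div, inv_mul_le_iff₀ (by positivity)]
    exact h1
  have hcont : ContinuousOn (fun t => relEntropy φ (f t)) (Ici 0) :=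
    ((hf.continuousOn_integral_comp Real.continuous_mul_log).sub continuousOn_const).congr hrel
  have hexp : ∀ t, 0 ≤ t → relEntropy φ (f t) ≤ relEntropy φ (f 0) * Real.exp (-(c * t)) := by
    intro t ht
    have hd : ∀ s, 0 < s → HasDerivAt (fun s => relEntropy φ (f s) * Real.exp (c * s))
        (deriv (fun s => relEntropy φ (f s)) s * Real.exp (c * s) +
          relEntropy φ (f s) * (Real.exp (c * s) * c)) s := fun s hs =>
      (hderiv s hs).differentiableAt.hasDerivAt.mul
        (((hasDerivAt_id s).const_mul c).exp.congr_deriv (by simp))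
    -- Gronwall's argument; continuity at `0` brings in the initial entropy, although the equation
    -- holds only for positive times.
    have hanti : AntitoneOn (fun s => relEntropy φ (f s) * Real.exp (c * s)) (Ici 0) := by
      refine antitoneOn_of_deriv_nonpos (convex_Ici 0)
        (hcont.mul (by fun_prop : Continuous fun s => Real.exp (c * s)).continuousOn) ?_ ?_
      · intro s hs
        exact (hd s (by simpa using hs)).differentiableAt.differentiableWithinAt
      · intro s hs
        have hs : 0 < s := by simpa using hs
        rw [(hd s hs).deriv]
        have h1 := mul_le_mul_of_nonneg_right (hdecay s hs) (Real.exp_pos (c * s)).le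
        linarith
    have h1 := hanti self_mem_Ici (mem_Ici.2 ht) ht
    simp only [mul_zero, Real.exp_zero, mul_one] at h1
    rw [Real.exp_neg, ← div_eq_mul_inv, le_div_iff₀ (Real.exp_pos _)]
    exact h1
  have hpinsker : ∀ t, 0 ≤ t → l1Dist φ (f t) ^ 2 ≤ 2 * φ * relEntropy φ (f t) := fun t ht =>
    sq_l1Dist_le (hf.continuous_slice ht) (hf.nonneg t ht) (hmass t ht)
  refine ⟨fun t ht => ⟨integrableOn_fisherDensity (hf.contDiff_slice ht) (hf.nonneg t ht.le),
    hderiv t ht, hfisher t ht, hdecay t ht⟩, hexp, hpinsker, ?_⟩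
  have hφ0 : 0 ≤ φ := hφ ▸ integral_nonneg fun ξ => hf.nonneg 0 le_rfl ξ.1 ξ.2
  have hlim : Tendsto (fun t => 2 * φ * (relEntropy φ (f 0) * Real.exp (-(c * t)))) atTop
      (𝓝 0) := by
    have h1 : Tendsto (fun t => Real.exp (-(c * t))) atTop (𝓝 0) :=
      Real.tendsto_exp_neg_atTop_nhds_zero.comp (tendsto_id.const_mul_atTop hc0)
    simpa using (h1.const_mul (relEntropy φ (f 0))).const_mul (2 * φ)
  have hsq : Tendsto (fun t => l1Dist φ (f t) ^ 2) atTop (𝓝 0) := by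
    refine tendsto_of_tendsto_of_tendsto_of_le_of_le' tendsto_const_nhds hlim
      (Eventually.of_forall fun t => sq_nonneg _) ?_
    filter_upwards [eventually_ge_atTop 0] with t ht
    exact (hpinsker t ht).trans
      (mul_le_mul_of_nonneg_left (hexp t ht) (by positivity))
  have habs : ∀ t, 0 ≤ l1Dist φ (f t) := fun t => integral_nonneg fun _ => abs_nonneg _
  simpa [Real.sqrt_sq (habs _)] using hsq.sqrt
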